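/- Notation. $B_m$ is the $m$-th Bernoulli polynomial, defined by $\frac{te^{tx}}{e^t-1}=\sum_{m\ge 0}B_m(x)\frac{t^m}{m!}$, and $b_m(x)=B_m(\{x\})$ is the corresponding $1$-periodic Bernoulli spline, $\{x\}$ being the fractional part of $x$. $V_a^b(f)$ is the total variation of $f$ on $[a,b]$ (on $[a,+\infty)$ if $b=\infty$). Functions are real-valued; derivatives at the left endpoint of a half-line are one-sided. Stieltjes integrals $\int f\,dg$ are Riemann–Stieltjes integrals, with $\int_0^\infty=\lim_{T\to\infty}\int_0^T$, and $\sum_{k=1}^\infty$ is the limit of the partial sums. For $q\le 0$, $n\in\{0,1,2,\dots\}$, $F\in C^n[q,+\infty)$, $\varepsilon>0$ and $u\in\mathbb R$ with $\varepsilon u\ge q$, put $$L_n(\varepsilon,u)=\int_0^\infty b_{n+1}\!\left(\frac t\varepsilon\right)dF^{(n)}(t+\varepsilon u)+\int_0^1 B_{n+1}(-u+ut)\,dF^{(n)}(t\varepsilon u).$$ **Theorem.** **1.** Let $n\in\{0,1,2,\dots\}$, let $F\in C^n[0,+\infty)\cap L^1[0,+\infty)$, let $F^{(n)}$ be of bounded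 variation on $[0,+\infty)$, and let $F^{(k)}(x)\to 0$ as $x\to+\infty$ for $0\le k\le n$. Then for all $\varepsilon>0$ and $u\ge 0$ both integrals in $L_n(\varepsilon,u)$ exist, the series below converges, $$\sum_{k=1}^\infty F(\varepsilon k+\varepsilon u)=\frac1\varepsilon\int_0^\infty F(t)\,dt+\sum_{k=0}^n\frac{(-1)^k\varepsilon^k}{(k+1)!}B_{k+1}(-u)F^{(k)}(0)+\frac{(-1)^n\varepsilon^n}{(n+1)!}L_n(\varepsilon,u),\qquad(*)$$ and $$|L_n(\varepsilon,u)|\le\sup_{0\le x\le1}|b_{n+1}(x)|\,V_{\varepsilon u}^\infty(F^{(n)})+\sup_{-u\le x\le0}|B_{n+1}(x)|\,V_0^{\varepsilon u}(F^{(n)}).$$ If, in addition, $F^{(n)}$ is absolutely continuous on $[0,T]$ for every $T>0$, then for every $a>0$, $L_n(\varepsilon,u)\to0$ as $\varepsilon\to+0$, uniformly in $u\in[0,a]$. **2.** Let $q<0$, $n\in\{0,1,2,\dots\}$, let $F\in C^n[q,+\infty)\cap L^1[q,+\infty)$, let $F^{(n)}$ be of bounded variation on $[q,+\infty)$, and let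 $F^{(k)}(x)\to 0$ as $x\to+\infty$ for $0\le k\le n$. Then for all $u<0$ and $\varepsilon\in(0,q/u)$ both integrals in $L_n(\varepsilon,u)$ exist, the series in $(*)$ converges, $(*)$ holds, and $$|L_n(\varepsilon,u)|\le\sup_{0\le x\le1}|b_{n+1}(x)|\,V_{\varepsilon u}^\infty(F^{(n)})+\sup_{0\le x\le-u}|B_{n+1}(x)|\,V_{\varepsilon u}^0(F^{(n)}).$$ If, in addition, $F^{(n)}$ is absolutely continuous on $[q,T]$ for every $T>q$, then for every $b<0$, $L_n(\varepsilon,u)\to0$ as $\varepsilon\to+0$, uniformly in $u\in[b,0]$. -/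

import Mathlib

open Set Filter Topology MeasureTheory

/-- `I` is the Riemann–Stieltjes integral `∫_a^b f dg` (with `a ≤ b`): the sums
`∑ f(ξ_i) (g(x_{i+1}) - g(x_i))` over tagged partitions `a = x_0 ≤ ξ_0 ≤ x_1 ≤ ⋯ ≤ x_N = b`
tend to `I` as the mesh tends to `0`. -/
def HasRSIntegral (f g : ℝ → ℝ) (a b I : ℝ) : Prop :=
  a ≤ b ∧ ∀ η > 0, ∃ δ > 0, ∀ (N : ℕ) (x ξ : ℕ → ℝ), x 0 = a → x N = b →
    (∀ i < N, x i ≤ ξ i ∧ ξ i ≤ x (i + 1) ∧ x (i + 1) - x i < δ) →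
    |∑ i ∈ Finset.range N, f (ξ i) * (g (x (i + 1)) - g (x i)) - I| < η

/-- `I` is the improper Riemann–Stieltjes integral `∫_a^∞ f dg = lim_{T → ∞} ∫_a^T f dg`. -/
def HasImproperRSIntegral (f g : ℝ → ℝ) (a I : ℝ) : Prop :=
  ∃ J : ℝ → ℝ, (∀ T, a ≤ T → HasRSIntegral f g a T (J T)) ∧ Tendsto J atTop (𝓝 I)

theorem HasRSIntegral.unique {f g : ℝ → ℝ} {a b I I' : ℝ}
    (h : HasRSIntegral f g a b I) (h' : HasRSIntegral f g a b I') : I = I' := by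
  obtain ⟨hab, h⟩ := h
  obtain ⟨-, h'⟩ := h'
  by_contra hne
  have hpos : 0 < |I - I'| / 2 := by
    have := abs_pos.mpr (sub_ne_zero.mpr hne)
    linarith
  obtain ⟨δ, hδ, H⟩ := h _ hpos
  obtain ⟨δ', hδ', H'⟩ := h' _ hpos
  obtain ⟨N, hN⟩ := exists_nat_gt ((b - a) / min δ δ')
  have hm : 0 < min δ δ' := lt_min hδ hδ'
  have hN0 : (0 : ℝ) < N := lt_of_le_of_lt (div_nonneg (by linarith) hm.le) hN
  have hstep : (b - a) / N < min δ δ' := by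
    rw [div_lt_iff₀ hm] at hN
    rw [div_lt_iff₀ hN0]
    linarith
  have hs0 : 0 ≤ (b - a) / N := div_nonneg (by linarith) hN0.le
  let x : ℕ → ℝ := fun i => a + i * ((b - a) / N)
  have hx0 : x 0 = a := by simp [x]
  have hxN : x N = b := by
    simp only [x]
    field_simp
    ring
  have hd : ∀ i, x (i + 1) - x i = (b - a) / N := by
    intro i
    simp only [x]
    push_cast
    ring
  have e1 := H N x x hx0 hxN (fun i _ => ⟨le_rfl, by linarith [hd i],
    by rw [hd i]; exact lt_of_lt_of_le hstep (min_le_left _ _)⟩)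
  have e2 := H' N x x hx0 hxN (fun i _ => ⟨le_rfl, by linarith [hd i],
    by rw [hd i]; exact lt_of_lt_of_le hstep (min_le_right _ _)⟩)
  set S := ∑ i ∈ Finset.range N, f (x i) * (g (x (i + 1)) - g (x i))
  have e3 : |I - I'| ≤ |S - I| + |S - I'| := by
    have : I - I' = (S - I') - (S - I) := by ring
    rw [this]
    have := abs_sub (S - I') (S - I)
    linarith
  linarith

theorem HasImproperRSIntegral.unique {f g : ℝ → ℝ} {a I I' : ℝ}
    (h : HasImproperRSIntegral f g a I) (h' : HasImproperRSIntegral f g a I') : I = I' := by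
  obtain ⟨J, hJ, hl⟩ := h
  obtain ⟨J', hJ', hl'⟩ := h'
  refine tendsto_nhds_unique hl (hl'.congr' ?_)
  filter_upwards [eventually_ge_atTop a] with T hT
  exact (hJ' T hT).unique (hJ T hT)

open scoped Classical in
/-- The Riemann–Stieltjes integral `∫_a^b f dg` (and `0` if it does not exist). -/
noncomputable def rsIntegral (f g : ℝ → ℝ) (a b : ℝ) : ℝ :=
  if h : ∃ I, HasRSIntegral f g a b I then h.choose else 0

open scoped Classical in
/-- The improper Riemann–Stieltjes integral `∫_a^∞ f dg` (and `0` if it does not exist). -/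
noncomputable def improperRSIntegral (f g : ℝ → ℝ) (a : ℝ) : ℝ :=
  if h : ∃ I, HasImproperRSIntegral f g a I then h.choose else 0

/-- The Bernoulli spline `b_n(x) = B_n({x})`. -/
noncomputable def bernoulliSpline (n : ℕ) (x : ℝ) : ℝ :=
  bernoulliFun n (Int.fract x)

/-- The remainder
`L_n(ε,u) = ∫_0^∞ b_{n+1}(t/ε) dD(t+εu) + ∫_0^1 B_{n+1}(-u+ut) dD(tεu)`,
where `D` stands for the `n`-th derivative of the function under consideration. -/
noncomputable def emRemainder (n : ℕ) (D : ℝ → ℝ) (ε u : ℝ) : ℝ :=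
  improperRSIntegral (fun t => bernoulliSpline (n + 1) (t / ε)) (fun t => D (t + ε * u)) 0 +
    rsIntegral (fun t => bernoulliFun (n + 1) (-u + u * t)) (fun t => D (t * ε * u)) 0 1

/-- Both Stieltjes integrals in `L_n(ε,u)` exist. -/
def EMRemainderExists (n : ℕ) (D : ℝ → ℝ) (ε u : ℝ) : Prop :=
  (∃ I, HasImproperRSIntegral
    (fun t => bernoulliSpline (n + 1) (t / ε)) (fun t => D (t + ε * u)) 0 I) ∧
  ∃ I, HasRSIntegral
    (fun t => bernoulliFun (n + 1) (-u + u * t)) (fun t => D (t * ε * u)) 0 1 I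

/-- `sup_{x ∈ s} |f(x)|`, used for bounded `f` and nonempty `s`. -/
noncomputable def supAbs (f : ℝ → ℝ) (s : Set ℝ) : ℝ :=
  sSup ((fun x => |f x|) '' s)

/-! ### Riemann–Stieltjes integrals -/

/-! The formula comes from repeated integration by parts against Bernoulli kernels. The sawtooth
`b_1(t/ε)` is `t/ε - 1/2` minus unit steps at the points `εk`, so integrating `∫ b_1(t/ε) dg` by
parts produces `∑ g(εk)`; with `g(t) = F(t + εu)` this is the series. For `m ≥ 2` the spline is
continuous and is a primitive of `m b_{m-1}`, so a further integration by parts ties the integral of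
order `k + 2` against `F^{(k+1)}` to that of order `k + 1` against `F^{(k)}`.
`sum_eulerMaclaurin_of_recurrence` solves this recurrence.

On `[0, εp]` the result is `sum_tail_eq`, the Euler–Maclaurin formula started at `εu`, whose
boundary values there carry the weights `B_{k+1}(0)`. With `s = tεu`, the second integral of `L_n`
becomes that of `B_{n+1}(s/ε - u) dF^{(n)}(s)` from `0` to `εu`; the same recurrence (`sum_head_eq`)
trades the boundary values at `εu` for values at `0` with weights `B_{k+1}(-u)`. In the sum of the
two formulas the values at `εu` cancel, and those at `εp + εu` vanish as `p → ∞`.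

The last Stieltjes integrals, against the merely continuous `F^{(n)}`, exist because the kernel is
an indefinite integral plus finitely many steps on bounded intervals
(`hasRSIntegral_of_eq_integral`). Bounded variation gives convergence at infinity and the bound on
`L_n`.

If `F^{(n)}` is absolutely continuous, its derivative is approximated in `L¹` on `[q, T]` by a
smooth `φ`, against which the oscillating kernel integrates to `O(ε)`. The part beyond `T` is
controlled by the tail of the variation, the head by the variation between `0` and `εu`. None of
these estimates depends on `u` in a bounded set. -/

theorem partition_mem_Icc {N : ℕ} {x ξ : ℕ → ℝ} {a b : ℝ} (h0 : x 0 = a) (hN : x N = b)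
    (h : ∀ i < N, x i ≤ ξ i ∧ ξ i ≤ x (i + 1)) {i : ℕ} (hi : i ≤ N) : x i ∈ Icc a b := by
  have key : ∀ j k, j ≤ k → k ≤ N → x j ≤ x k := by
    intro j k hjk
    induction k, hjk using Nat.le_induction with
    | base => exact fun _ => le_rfl
    | succ k _ ih =>
      intro hk
      exact (ih (by omega)).trans ((h k (by omega)).1.trans (h k (by omega)).2)
  exact ⟨h0 ▸ key 0 i (Nat.zero_le _) hi, hN ▸ key i N hi le_rfl⟩

theorem partition_tag_mem_Icc {N : ℕ} {x ξ : ℕ → ℝ} {a b : ℝ} (h0 : x 0 = a) (hN : x N = b)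
    (h : ∀ i < N, x i ≤ ξ i ∧ ξ i ≤ x (i + 1)) {i : ℕ} (hi : i < N) : ξ i ∈ Icc a b :=
  ⟨(partition_mem_Icc h0 hN h hi.le).1.trans (h i hi).1,
    (h i hi).2.trans (partition_mem_Icc h0 hN h hi).2⟩

theorem HasRSIntegral.congr {f f' g g' : ℝ → ℝ} {a b I : ℝ} (h : HasRSIntegral f g a b I)
    (hf : EqOn f' f (Icc a b)) (hg : EqOn g' g (Icc a b)) : HasRSIntegral f' g' a b I := by
  refine ⟨h.1, fun η hη => ?_⟩
  obtain ⟨δ, hδ, H⟩ := h.2 η hη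
  refine ⟨δ, hδ, fun N x ξ h0 hN hx => ?_⟩
  have hx' : ∀ i < N, x i ≤ ξ i ∧ ξ i ≤ x (i + 1) := fun i hi => ⟨(hx i hi).1, (hx i hi).2.1⟩
  have := H N x ξ h0 hN hx
  rwa [Finset.sum_congr rfl fun i hi => ?_]
  rw [Finset.mem_range] at hi
  rw [hf (partition_tag_mem_Icc h0 hN hx' hi), hg (partition_mem_Icc h0 hN hx' hi.le),
    hg (partition_mem_Icc h0 hN hx' (Nat.succ_le_of_lt hi))]

theorem HasRSIntegral.sub {f₁ f₂ g : ℝ → ℝ} {a b I₁ I₂ : ℝ} (h₁ : HasRSIntegral f₁ g a b I₁)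
    (h₂ : HasRSIntegral f₂ g a b I₂) :
    HasRSIntegral (fun t => f₁ t - f₂ t) g a b (I₁ - I₂) := by
  refine ⟨h₁.1, fun η hη => ?_⟩
  obtain ⟨δ₁, hδ₁, H₁⟩ := h₁.2 (η / 2) (by linarith)
  obtain ⟨δ₂, hδ₂, H₂⟩ := h₂.2 (η / 2) (by linarith)
  refine ⟨min δ₁ δ₂, lt_min hδ₁ hδ₂, fun N x ξ h0 hN hx => ?_⟩
  have e₁ := H₁ N x ξ h0 hN fun i hi =>
    ⟨(hx i hi).1, (hx i hi).2.1, (hx i hi).2.2.trans_le (min_le_left _ _)⟩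
  have e₂ := H₂ N x ξ h0 hN fun i hi =>
    ⟨(hx i hi).1, (hx i hi).2.1, (hx i hi).2.2.trans_le (min_le_right _ _)⟩
  simp only [sub_mul, Finset.sum_sub_distrib]
  rw [abs_lt] at *
  constructor <;> linarith [e₁.1, e₁.2, e₂.1, e₂.2]

theorem HasRSIntegral.zero_left (g : ℝ → ℝ) {a b : ℝ} (hab : a ≤ b) :
    HasRSIntegral (fun _ => 0) g a b 0 :=
  ⟨hab, fun η hη => ⟨1, one_pos, fun N x ξ _ _ _ => by simpa using hη⟩⟩

theorem HasRSIntegral.add {f₁ f₂ g : ℝ → ℝ} {a b I₁ I₂ : ℝ} (h₁ : HasRSIntegral f₁ g a b I₁)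
    (h₂ : HasRSIntegral f₂ g a b I₂) :
    HasRSIntegral (fun t => f₁ t + f₂ t) g a b (I₁ + I₂) := by
  simpa using h₁.sub ((HasRSIntegral.zero_left g h₁.1).sub h₂)

theorem HasRSIntegral.sum {ι : Type*} (s : Finset ι) {f : ι → ℝ → ℝ} {g : ℝ → ℝ} {a b : ℝ}
    {I : ι → ℝ} (hab : a ≤ b) (h : ∀ i ∈ s, HasRSIntegral (f i) g a b (I i)) :
    HasRSIntegral (fun t => ∑ i ∈ s, f i t) g a b (∑ i ∈ s, I i) := by
  classical
  induction s using Finset.induction_on with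
  | empty => simpa using HasRSIntegral.zero_left g hab
  | insert j s hj ih =>
    simp only [Finset.sum_insert hj]
    exact (h j (Finset.mem_insert_self _ _)).add
      (ih fun i hi => h i (Finset.mem_insert_of_mem hi))

theorem HasRSIntegral.rsIntegral_eq {f g : ℝ → ℝ} {a b I : ℝ} (h : HasRSIntegral f g a b I) :
    rsIntegral f g a b = I := by
  have h' : ∃ I, HasRSIntegral f g a b I := ⟨I, h⟩
  rw [rsIntegral, dif_pos h']
  exact h'.choose_spec.unique h

theorem HasImproperRSIntegral.improperRSIntegral_eq {f g : ℝ → ℝ} {a I : ℝ}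
    (h : HasImproperRSIntegral f g a I) : improperRSIntegral f g a = I := by
  have h' : ∃ I, HasImproperRSIntegral f g a I := ⟨I, h⟩
  rw [improperRSIntegral, dif_pos h']
  exact h'.choose_spec.unique h

theorem HasRSIntegral.self (f g : ℝ → ℝ) (a : ℝ) : HasRSIntegral f g a a 0 := by
  refine ⟨le_rfl, fun η hη => ⟨1, one_pos, fun N x ξ h0 hN hx => ?_⟩⟩
  have hx' : ∀ i < N, x i ≤ ξ i ∧ ξ i ≤ x (i + 1) := fun i hi => ⟨(hx i hi).1, (hx i hi).2.1⟩
  have hxa : ∀ i ≤ N, x i = a := fun i hi =>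
    le_antisymm (partition_mem_Icc h0 hN hx' hi).2 (partition_mem_Icc h0 hN hx' hi).1
  rw [Finset.sum_eq_zero, sub_zero, abs_zero]
  · exact hη
  · intro i hi
    rw [Finset.mem_range] at hi
    rw [hxa i hi.le, hxa (i + 1) hi, sub_self, mul_zero]

/-- Integration by parts: if `f` is an indefinite integral with respect to a measure `μ` and `g` is
continuous, then `∫ f dg` exists. -/
theorem hasRSIntegral_of_eq_integral {f h g : ℝ → ℝ} {a b : ℝ} {μ : Measure ℝ} (hab : a ≤ b)
    (hh : IntervalIntegrable h μ a b) (hf : ∀ x ∈ Icc a b, f x = f a + ∫ t in a..x, h t ∂μ)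
    (hg : ContinuousOn g (Icc a b)) :
    HasRSIntegral f g a b (f b * g b - f a * g a - ∫ t in a..b, g t * h t ∂μ) := by
  refine ⟨hab, fun η hη => ?_⟩
  set V := ∫ t in a..b, |h t| ∂μ
  have hV : 0 ≤ V := intervalIntegral.integral_nonneg hab fun _ _ => abs_nonneg _
  -- Adding `1` makes `ω * V < η` hold even when `V = 0`.
  set ω := η / (V + 1)
  have hω : 0 < ω := by positivity
  have huc := isCompact_Icc.uniformContinuousOn_of_continuous hg
  obtain ⟨δ, hδ, H⟩ := Metric.uniformContinuousOn_iff.1 huc ω hω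
  refine ⟨δ, hδ, fun N x ξ h0 hN hx => ?_⟩
  have hx' : ∀ i < N, x i ≤ ξ i ∧ ξ i ≤ x (i + 1) := fun i hi => ⟨(hx i hi).1, (hx i hi).2.1⟩
  have hsub : ∀ {c d : ℝ}, c ∈ Icc a b → d ∈ Icc a b → uIcc c d ⊆ uIcc a b := fun hc hd => by
    rw [uIcc_of_le hab]
    exact ordConnected_Icc.uIcc_subset hc hd
  have hgh : IntervalIntegrable (fun t => g t * h t) μ a b :=
    hh.continuousOn_mul (by rwa [uIcc_of_le hab])
  have hfd : ∀ {c d : ℝ}, c ∈ Icc a b → d ∈ Icc a b → f d - f c = ∫ t in c..d, h t ∂μ := by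
    intro c d hc hd
    have ha : a ∈ Icc a b := ⟨le_rfl, hab⟩
    rw [hf c hc, hf d hd, ← intervalIntegral.integral_interval_sub_left
      (hh.mono_set (hsub ha hd)) (hh.mono_set (hsub ha hc))]
    ring
  have piece : ∀ {c d y : ℝ}, c ∈ Icc a b → d ∈ Icc a b → c ≤ d → y ∈ Icc a b →
      (∀ t ∈ Icc c d, |t - y| < δ) →
      |(∫ t in c..d, g t * h t ∂μ) - g y * (f d - f c)| ≤ ω * ∫ t in c..d, |h t| ∂μ := by
    intro c d y hc hd hcd hy hty
    have hh' := hh.mono_set (hsub hc hd)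
    rw [hfd hc hd, ← intervalIntegral.integral_const_mul, ← intervalIntegral.integral_const_mul,
      ← intervalIntegral.integral_sub (hgh.mono_set (hsub hc hd)) (hh'.const_mul _),
      ← Real.norm_eq_abs]
    refine intervalIntegral.norm_integral_le_of_norm_le hcd (ae_of_all _ fun t ht => ?_)
      (hh'.abs.const_mul _)
    rw [← sub_mul, norm_mul, Real.norm_eq_abs, Real.norm_eq_abs]
    refine mul_le_mul_of_nonneg_right ?_ (abs_nonneg _)
    have := H t ⟨hc.1.trans ht.1.le, ht.2.trans hd.2⟩ y hy
      (by rw [Real.dist_eq]; exact hty t ⟨ht.1.le, ht.2⟩)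
    rw [Real.dist_eq] at this
    exact this.le
  have hm : ∀ i ≤ N, x i ∈ Icc a b := fun i hi => partition_mem_Icc h0 hN hx' hi
  have ht : ∀ i < N, ξ i ∈ Icc a b := fun i hi => partition_tag_mem_Icc h0 hN hx' hi
  have s1 : ∑ i ∈ Finset.range N, (f (x (i + 1)) * g (x (i + 1)) - f (x i) * g (x i))
      = f b * g b - f a * g a := by
    rw [Finset.sum_range_sub (fun i => f (x i) * g (x i)), h0, hN]
  have s2 : ∑ i ∈ Finset.range N, ∫ t in x i..x (i + 1), g t * h t ∂μ
      = ∫ t in a..b, g t * h t ∂μ := by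
    rw [intervalIntegral.sum_integral_adjacent_intervals, h0, hN]
    exact fun k hk => hgh.mono_set (hsub (hm k hk.le) (hm _ hk))
  have s3 : ∑ i ∈ Finset.range N, ∫ t in x i..x (i + 1), |h t| ∂μ = V := by
    rw [intervalIntegral.sum_integral_adjacent_intervals, h0, hN]
    exact fun k hk => hh.abs.mono_set (hsub (hm k hk.le) (hm _ hk))
  -- Summation by parts with each cell split at its tag: on `[x i, ξ i]` the integrator `g` is
  -- frozen at the left node, on `[ξ i, x (i + 1)]` at the right node. Uniform continuity of `g`
  -- bounds the error by `ω` times the mass of `|h|`.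
  have key : |∑ i ∈ Finset.range N, ((∫ t in x i..x (i + 1), g t * h t ∂μ)
      - g (x (i + 1)) * (f (x (i + 1)) - f (ξ i)) - g (x i) * (f (ξ i) - f (x i)))| ≤ ω * V := by
    rw [← s3, Finset.mul_sum]
    refine (Finset.abs_sum_le_sum_abs _ _).trans (Finset.sum_le_sum fun i hi => ?_)
    rw [Finset.mem_range] at hi
    obtain ⟨h1, h2, h3⟩ := hx i hi
    have a1 := piece (hm i hi.le) (ht i hi) h1 (hm i hi.le) fun t ht => by
      rw [abs_lt]; constructor <;> linarith [ht.1, ht.2]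
    have a2 := piece (ht i hi) (hm _ hi) h2 (hm _ hi) fun t ht => by
      rw [abs_lt]; constructor <;> linarith [ht.1, ht.2]
    rw [← intervalIntegral.integral_add_adjacent_intervals
        (hgh.mono_set (hsub (hm i hi.le) (ht i hi))) (hgh.mono_set (hsub (ht i hi) (hm _ hi))),
      ← intervalIntegral.integral_add_adjacent_intervals
        (hh.abs.mono_set (hsub (hm i hi.le) (ht i hi)))
        (hh.abs.mono_set (hsub (ht i hi) (hm _ hi))), mul_add]
    rw [abs_le] at *
    constructor <;> linarith [a1.1, a1.2, a2.1, a2.2]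
  have e : ∑ i ∈ Finset.range N, f (ξ i) * (g (x (i + 1)) - g (x i))
      - (f b * g b - f a * g a - ∫ t in a..b, g t * h t ∂μ)
      = ∑ i ∈ Finset.range N, ((∫ t in x i..x (i + 1), g t * h t ∂μ)
      - g (x (i + 1)) * (f (x (i + 1)) - f (ξ i)) - g (x i) * (f (ξ i) - f (x i))) := by
    rw [← s1, ← s2, ← Finset.sum_sub_distrib, ← Finset.sum_sub_distrib]
    exact Finset.sum_congr rfl fun i _ => by ring
  rw [e]
  refine key.trans_lt ?_
  rw [div_mul_eq_mul_div, div_lt_iff₀ (by positivity)]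
  nlinarith

/-- A step is the indefinite integral of a Dirac mass. Interval integrals run over `(a, x]`, which
is why the step is closed on the left and `c = a` is excluded. -/
theorem hasRSIntegral_indicator_Ici {g : ℝ → ℝ} {a b c : ℝ} (hc : c ∈ Ioc a b)
    (hg : ContinuousOn g (Icc a b)) :
    HasRSIntegral ((Ici c).indicator fun _ => 1) g a b (g b - g c) := by
  have hab : a ≤ b := hc.1.le.trans hc.2
  have hint : ∀ x ∈ Icc a b, ∀ h : ℝ → ℝ, ∫ t in a..x, h t ∂(Measure.dirac c)
      = (Ici c).indicator (fun _ => h c) x := by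
    intro x hx h
    rw [intervalIntegral.integral_of_le hx.1, setIntegral_dirac]
    by_cases hcx : c ≤ x
    · rw [if_pos ⟨hc.1, hcx⟩, indicator_of_mem (show x ∈ Ici c from hcx)]
    · rw [if_neg (fun h => hcx h.2), indicator_of_notMem (show x ∉ Ici c from hcx)]
  have ha : (Ici c).indicator (fun _ => (1 : ℝ)) a = 0 :=
    indicator_of_notMem (not_le.2 hc.1) _
  have := hasRSIntegral_of_eq_integral (μ := Measure.dirac c)
    (f := (Ici c).indicator fun _ => 1) (h := fun _ => 1) hab
    (intervalIntegrable_const) (fun x hx => by rw [hint x hx, ha, zero_add]) hg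
  rw [hint b ⟨hab, le_rfl⟩, ha, indicator_of_mem (show b ∈ Ici c from hc.2),
    indicator_of_mem (show b ∈ Ici c from hc.2)] at this
  simpa using this

theorem exists_uniform_partition {a b : ℝ} (hab : a ≤ b) {δ : ℝ} (hδ : 0 < δ) :
    ∃ (N : ℕ) (x : ℕ → ℝ), Monotone x ∧ x 0 = a ∧ x N = b ∧ ∀ i, x (i + 1) - x i < δ := by
  obtain ⟨N, hN⟩ := exists_nat_gt ((b - a) / δ)
  have hN0 : (0 : ℝ) < N := lt_of_le_of_lt (div_nonneg (by linarith) hδ.le) hN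
  have hs0 : 0 ≤ (b - a) / N := div_nonneg (by linarith) hN0.le
  refine ⟨N, fun i => a + i * ((b - a) / N), ?_, by simp, by field_simp; ring, fun i => ?_⟩
  · intro i j hij
    have : (i : ℝ) ≤ j := by exact_mod_cast hij
    have := mul_le_mul_of_nonneg_right this hs0
    simp only
    linarith
  · rw [div_lt_iff₀ hδ] at hN
    have : (b - a) / N < δ := by rw [div_lt_iff₀ hN0]; linarith
    push_cast
    linarith

/-- Two integrals with the same left endpoint differ by at most the bound for the integrand times
the variation of the integrator in between. -/
theorem HasRSIntegral.abs_sub_le {f g : ℝ → ℝ} {a b c I I' M : ℝ} (h : HasRSIntegral f g a b I)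
    (h' : HasRSIntegral f g a c I') (hbc : b ≤ c) (hM : ∀ x ∈ Icc b c, |f x| ≤ M)
    (hg : BoundedVariationOn g (Icc b c)) :
    |I' - I| ≤ M * (eVariationOn g (Icc b c)).toReal := by
  refine le_of_forall_pos_le_add fun η hη => ?_
  obtain ⟨hab, h⟩ := h
  obtain ⟨-, h'⟩ := h'
  obtain ⟨δ, hδ, H⟩ := h (η / 2) (by linarith)
  obtain ⟨δ', hδ', H'⟩ := h' (η / 2) (by linarith)
  obtain ⟨N, x, hxm, hx0, hxN, hxd⟩ := exists_uniform_partition hab (lt_min hδ hδ')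
  obtain ⟨K, y, hym, hy0, hyK, hyd⟩ := exists_uniform_partition hbc (lt_min hδ hδ')
  -- Gluing a fine partition of `[b, c]` to one of `[a, b]` makes the two Riemann sums differ by the
  -- sum over `[b, c]` alone, so no integral over `[b, c]` is needed.
  set z : ℕ → ℝ := fun i => if i ≤ N then x i else y (i - N)
  have hzx : ∀ i ≤ N, z i = x i := fun i hi => if_pos hi
  have hzy : ∀ i, z (N + i) = y i := by
    intro i
    rcases Nat.eq_zero_or_pos i with rfl | hi
    · rw [add_zero, hzx N le_rfl, hxN, hy0]
    · simp only [z]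
      rw [if_neg (by omega), Nat.add_sub_cancel_left]
  have hz1 : ∀ i < N, z i = x i ∧ z (i + 1) = x (i + 1) := fun i hi =>
    ⟨hzx i hi.le, hzx _ hi⟩
  have hz2 : ∀ i, z (N + i) = y i ∧ z (N + i + 1) = y (i + 1) := fun i => ⟨hzy i, hzy (i + 1)⟩
  have e := H N x x hx0 hxN fun i _ =>
    ⟨le_rfl, hxm i.le_succ, (hxd i).trans_le (min_le_left _ _)⟩
  have e' := H' (N + K) z z (by rw [hzx 0 (Nat.zero_le _), hx0]) (by rw [hzy, hyK]) fun i _ => by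
    rcases lt_or_ge i N with hi | hi
    · rw [(hz1 i hi).1, (hz1 i hi).2]
      exact ⟨le_rfl, hxm i.le_succ, (hxd i).trans_le (min_le_right _ _)⟩
    · obtain ⟨j, rfl⟩ := Nat.exists_eq_add_of_le hi
      rw [(hz2 j).1, (hz2 j).2]
      exact ⟨le_rfl, hym j.le_succ, (hyd j).trans_le (min_le_right _ _)⟩
  rw [Finset.sum_range_add] at e'
  have s1 : ∑ i ∈ Finset.range N, f (z i) * (g (z (i + 1)) - g (z i))
      = ∑ i ∈ Finset.range N, f (x i) * (g (x (i + 1)) - g (x i)) :=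
    Finset.sum_congr rfl fun i hi => by
      rw [(hz1 i (Finset.mem_range.1 hi)).1, (hz1 i (Finset.mem_range.1 hi)).2]
  have s2 : ∑ i ∈ Finset.range K, f (z (N + i)) * (g (z (N + i + 1)) - g (z (N + i)))
      = ∑ i ∈ Finset.range K, f (y i) * (g (y (i + 1)) - g (y i)) :=
    Finset.sum_congr rfl fun i _ => by rw [(hz2 i).1, (hz2 i).2]
  rw [s1, s2] at e'
  have hymem : ∀ i ∈ Icc 0 K, y i ∈ Icc b c := fun i hi =>
    ⟨hy0 ▸ hym (Nat.zero_le i), hyK ▸ hym hi.2⟩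
  have hvar : ∑ i ∈ Finset.range K, |g (y (i + 1)) - g (y i)|
      ≤ (eVariationOn g (Icc b c)).toReal := by
    have := eVariationOn.sum_le_of_monotoneOn_Icc (f := g) (hym.monotoneOn (Icc 0 K)) hymem
    rw [← Finset.range_eq_Ico] at this
    refine le_trans (le_of_eq ?_) (ENNReal.toReal_mono hg this)
    rw [ENNReal.toReal_sum fun i _ => edist_ne_top _ _]
    exact Finset.sum_congr rfl fun i _ => by rw [← dist_edist, Real.dist_eq]
  have hM0 : 0 ≤ M := (abs_nonneg _).trans (hM b ⟨le_rfl, hbc⟩)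
  have s3 : |∑ i ∈ Finset.range K, f (y i) * (g (y (i + 1)) - g (y i))|
      ≤ M * (eVariationOn g (Icc b c)).toReal := by
    refine (Finset.abs_sum_le_sum_abs _ _).trans ?_
    refine le_trans ?_ (mul_le_mul_of_nonneg_left hvar hM0)
    rw [Finset.mul_sum]
    refine Finset.sum_le_sum fun i hi => ?_
    rw [abs_mul]
    exact mul_le_mul_of_nonneg_right
      (hM _ (hymem i ⟨Nat.zero_le _, (Finset.mem_range.1 hi).le⟩)) (abs_nonneg _)
  rw [abs_lt] at e e'
  rw [abs_le] at *
  constructor <;> linarith [e.1, e.2, e'.1, e'.2, s3.1, s3.2]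

theorem HasRSIntegral.abs_le {f g : ℝ → ℝ} {a b I M : ℝ} (h : HasRSIntegral f g a b I)
    (hM : ∀ x ∈ Icc a b, |f x| ≤ M) (hg : BoundedVariationOn g (Icc a b)) :
    |I| ≤ M * (eVariationOn g (Icc a b)).toReal := by
  simpa using (HasRSIntegral.self f g a).abs_sub_le h h.1 hM hg

/-- For a bounded integrand and an integrator of bounded variation, the improper integral exists
once the proper ones do, with an estimate for the tails. -/
theorem exists_hasImproperRSIntegral {f g J : ℝ → ℝ} {a M : ℝ}
    (hJ : ∀ T, a ≤ T → HasRSIntegral f g a T (J T)) (hM : ∀ x, |f x| ≤ M)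
    (hg : BoundedVariationOn g (Ici a)) :
    ∃ I, HasImproperRSIntegral f g a I ∧ Tendsto J atTop (𝓝 I) ∧
      ∀ T, a ≤ T → |I - J T| ≤ M * (eVariationOn g (Ici T)).toReal := by
  have hM0 : 0 ≤ M := (abs_nonneg _).trans (hM 0)
  have hgT : ∀ T, a ≤ T → BoundedVariationOn g (Ici T) := fun T hT =>
    hg.mono (Ici_subset_Ici.2 hT)
  have hb : ∀ T T', a ≤ T → T ≤ T' → |J T' - J T| ≤ M * (eVariationOn g (Ici T)).toReal := by
    intro T T' hT hTT'
    refine ((hJ T hT).abs_sub_le (hJ T' (hT.trans hTT')) hTT' (fun x _ => hM x)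
      ((hgT T hT).mono Icc_subset_Ici_self)).trans ?_
    exact mul_le_mul_of_nonneg_left (ENNReal.toReal_mono (hgT T hT)
      (eVariationOn.mono _ Icc_subset_Ici_self)) hM0
  have hv : Tendsto (fun T => M * (eVariationOn g (Ici T)).toReal) atTop (𝓝 0) := by
    have h1 := hg.tendsto_eVariationOn_Ici_zero
    have h2 : 𝓟 (Ici a) ⊓ (atTop : Filter ℝ) = atTop := by
      rw [inf_eq_right, le_principal_iff]
      exact Ici_mem_atTop a
    rw [h2] at h1
    have h3 := (ENNReal.tendsto_toReal ENNReal.zero_ne_top).comp h1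
    have h4 : Tendsto (fun T => (eVariationOn g (Ici T)).toReal) atTop (𝓝 0) := by
      refine Tendsto.congr' ?_ h3
      filter_upwards [eventually_ge_atTop a] with T hT
      simp only [Function.comp_apply]
      rw [inter_eq_self_of_subset_right (Ici_subset_Ici.2 hT)]
    simpa using h4.const_mul M
  have hc : CauchySeq J := by
    rw [Metric.cauchySeq_iff']
    intro η hη
    obtain ⟨T, hT, hTa⟩ := ((hv.eventually (gt_mem_nhds hη)).and (eventually_ge_atTop a)).exists
    exact ⟨T, fun T' hT' => by rw [Real.dist_eq]; exact (hb T T' hTa hT').trans_lt hT⟩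
  obtain ⟨I, hI⟩ := cauchySeq_tendsto_of_complete hc
  refine ⟨I, ⟨J, hJ, hI⟩, hI, fun T hT => ?_⟩
  refine le_of_tendsto (hI.sub_const (J T)).abs ?_
  filter_upwards [eventually_ge_atTop T] with T' hT' using hb T T' hT hT'

/-! ### Indefinite integrals -/

/-- `g` is an indefinite Lebesgue integral of `g'` on `[a, b]`. -/
def IsPrimitiveOn (g g' : ℝ → ℝ) (a b : ℝ) : Prop :=
  IntervalIntegrable g' volume a b ∧ ∀ x ∈ Icc a b, g x = g a + ∫ t in a..x, g' t

namespace IsPrimitiveOn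

variable {f f' g g' : ℝ → ℝ} {a b : ℝ}

theorem integral_eq (hg : IsPrimitiveOn g g' a b) {c d : ℝ} (hc : c ∈ Icc a b)
    (hd : d ∈ Icc a b) : ∫ t in c..d, g' t = g d - g c := by
  have hab : a ≤ b := hc.1.trans hc.2
  have hsub : ∀ {x : ℝ}, x ∈ Icc a b → uIcc a x ⊆ uIcc a b := fun hx => by
    rw [uIcc_of_le hab]
    exact ordConnected_Icc.uIcc_subset ⟨le_rfl, hab⟩ hx
  rw [hg.2 c hc, hg.2 d hd, ← intervalIntegral.integral_interval_sub_left
    (hg.1.mono_set (hsub hd)) (hg.1.mono_set (hsub hc))]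
  ring

/-- Integration by parts for indefinite integrals. -/
theorem integral_mul_eq (hab : a ≤ b) (hf : IsPrimitiveOn f f' a b)
    (hg : IsPrimitiveOn g g' a b) :
    ∫ t in a..b, f t * g' t = f b * g b - f a * g a - ∫ t in a..b, g t * f' t := by
  have hac : ∀ {k k' : ℝ → ℝ}, IsPrimitiveOn k k' a b →
      AbsolutelyContinuousOnInterval (fun x => k a + ∫ t in a..x, k' t) a b := fun hk =>
    (LipschitzOnWith.absolutelyContinuousOnInterval
      ((LipschitzWith.const _).lipschitzOnWith (K := 0))).add
      (hk.1.absolutelyContinuousOnInterval_intervalIntegral left_mem_uIcc)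
  -- Lebesgue differentiation: the derivative of the indefinite integral is the given density almost
  -- everywhere, which suffices under the integral sign.
  have hd : ∀ {k k' : ℝ → ℝ}, IsPrimitiveOn k k' a b → ∀ᵐ x, x ∈ uIcc a b →
      deriv (fun x => k a + ∫ t in a..x, k' t) x = k' x := fun hk => by
    filter_upwards [hk.1.ae_hasDerivAt_integral] with x hx hxab
    exact ((hx hxab a left_mem_uIcc).const_add _).deriv
  have h := (hac hf).integral_mul_deriv_eq_deriv_mul (hac hg)
  have e : ∀ x ∈ Icc a b, f a + ∫ t in a..x, f' t = f x := fun x hx => (hf.2 x hx).symm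
  have e' : ∀ x ∈ Icc a b, g a + ∫ t in a..x, g' t = g x := fun x hx => (hg.2 x hx).symm
  have ha : a ∈ Icc a b := ⟨le_rfl, hab⟩
  have hb : b ∈ Icc a b := ⟨hab, le_rfl⟩
  simp only [e a ha, e' a ha, e b hb, e' b hb] at h
  have i1 : ∫ t in a..b, f t * g' t = ∫ x in a..b, (f a + ∫ t in a..x, f' t) *
      deriv (fun x => g a + ∫ t in a..x, g' t) x := by
    refine intervalIntegral.integral_congr_ae ?_
    filter_upwards [hd hg] with x hx hxab
    have hx' := uIoc_subset_uIcc hxab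
    rw [hx hx', e x (by rwa [uIcc_of_le hab] at hx')]
  have i2 : ∫ t in a..b, g t * f' t = ∫ x in a..b,
      deriv (fun x => f a + ∫ t in a..x, f' t) x * (g a + ∫ t in a..x, g' t) := by
    refine intervalIntegral.integral_congr_ae ?_
    filter_upwards [hd hf] with x hx hxab
    have hx' := uIoc_subset_uIcc hxab
    rw [hx hx', e' x (by rwa [uIcc_of_le hab] at hx'), mul_comm]
  rw [i1, i2, h]

theorem hasRSIntegral (hab : a ≤ b) (hf : IsPrimitiveOn f f' a b)
    (hg : ContinuousOn g (Icc a b)) :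
    HasRSIntegral f g a b (f b * g b - f a * g a - ∫ t in a..b, g t * f' t) :=
  hasRSIntegral_of_eq_integral hab hf.1 hf.2 hg

theorem of_hasDerivAt (hg : ContinuousOn g (Icc a b)) (hd : ∀ x ∈ Ioo a b, HasDerivAt g (g' x) x)
    (hi : IntervalIntegrable g' volume a b) : IsPrimitiveOn g g' a b := by
  refine ⟨hi, fun x hx => ?_⟩
  rw [intervalIntegral.integral_eq_sub_of_hasDerivAt_of_le hx.1
    (hg.mono (Icc_subset_Icc_right hx.2)) (fun y hy => hd y ⟨hy.1, hy.2.trans_le hx.2⟩)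
    (hi.mono_set ?_)]
  · ring
  · rw [uIcc_of_le hx.1, uIcc_of_le (hx.1.trans hx.2)]
    exact Icc_subset_Icc_right hx.2

theorem of_absolutelyContinuousOnInterval (hab : a ≤ b)
    (hg : AbsolutelyContinuousOnInterval g a b) : IsPrimitiveOn g (deriv g) a b := by
  refine ⟨hg.intervalIntegrable_deriv, fun x hx => ?_⟩
  rw [(hg.mono ?_).integral_deriv_eq_sub]
  · ring
  · rw [uIcc_of_le hx.1, uIcc_of_le hab]
    exact Icc_subset_Icc_right hx.2

theorem comp_add_right {c : ℝ} (hg : IsPrimitiveOn g g' (a + c) (b + c)) :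
    IsPrimitiveOn (fun t => g (t + c)) (fun t => g' (t + c)) a b := by
  refine ⟨by simpa using hg.1.comp_add_right c, fun x hx => ?_⟩
  rw [intervalIntegral.integral_comp_add_right]
  exact hg.2 _ ⟨by linarith [hx.1], by linarith [hx.2]⟩

theorem mono {c d : ℝ} (hg : IsPrimitiveOn g g' a b) (hac : a ≤ c) (hcd : c ≤ d) (hdb : d ≤ b) :
    IsPrimitiveOn g g' c d := by
  refine ⟨hg.1.mono_set ?_, fun x hx => ?_⟩
  · rw [uIcc_of_le hcd, uIcc_of_le (hac.trans (hcd.trans hdb))]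
    exact Icc_subset_Icc hac hdb
  · rw [hg.integral_eq ⟨hac, hcd.trans hdb⟩ ⟨hac.trans hx.1, hx.2.trans hdb⟩]
    ring

end IsPrimitiveOn

/-! ### Bernoulli splines -/

theorem le_supAbs {f : ℝ → ℝ} {s : Set ℝ} {C x : ℝ} (hf : ∀ y ∈ s, |f y| ≤ C) (hx : x ∈ s) :
    |f x| ≤ supAbs f s :=
  le_csSup ⟨C, by rintro _ ⟨y, hy, rfl⟩; exact hf y hy⟩ ⟨x, hx, rfl⟩

theorem abs_le_supAbs_of_isCompact {f : ℝ → ℝ} {s : Set ℝ} (hs : IsCompact s)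
    (hf : ContinuousOn f s) {x : ℝ} (hx : x ∈ s) : |f x| ≤ supAbs f s := by
  obtain ⟨C, hC⟩ := hs.exists_bound_of_continuousOn hf
  exact le_supAbs (fun y hy => hC y hy) hx

theorem supAbs_nonneg (f : ℝ → ℝ) (s : Set ℝ) : 0 ≤ supAbs f s :=
  Real.sSup_nonneg (by rintro _ ⟨y, _, rfl⟩; exact abs_nonneg _)

theorem bernoulliSpline_natCast (m p : ℕ) : bernoulliSpline m p = bernoulliFun m 0 := by
  simp [bernoulliSpline]

theorem bernoulliSpline_zero_left (x : ℝ) : bernoulliSpline 0 x = 1 := by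
  simp [bernoulliSpline]

theorem abs_bernoulliSpline_le (m : ℕ) (x : ℝ) :
    |bernoulliSpline m x| ≤ supAbs (bernoulliSpline m) (Icc 0 1) := by
  have hfr : ∀ y : ℝ, Int.fract y ∈ Icc (0 : ℝ) 1 := fun y =>
    ⟨Int.fract_nonneg y, (Int.fract_lt_one y).le⟩
  obtain ⟨C, hC⟩ := (isCompact_Icc (a := (0 : ℝ)) (b := 1)).exists_bound_of_continuousOn
    (continuous_bernoulliFun m).continuousOn
  have h := le_supAbs (f := bernoulliSpline m) (s := Icc 0 1) (C := C)
    (fun y _ => hC _ (hfr y)) (hfr x)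
  rwa [bernoulliSpline, Int.fract_fract] at h

theorem measurable_bernoulliSpline (m : ℕ) : Measurable (bernoulliSpline m) :=
  (continuous_bernoulliFun m).measurable.comp measurable_fract

theorem continuous_bernoulliSpline {m : ℕ} (hm : m ≠ 1) : Continuous (bernoulliSpline m) :=
  (continuous_bernoulliFun m).continuousOn.comp_fract''
    (bernoulliFun_endpoints_eq_of_ne_one hm).symm

theorem intervalIntegrable_bernoulliSpline_div (m : ℕ) (ε a b : ℝ) :
    IntervalIntegrable (fun t => bernoulliSpline m (t / ε)) volume a b := by
  refine (intervalIntegrable_const (c := supAbs (bernoulliSpline m) (Icc 0 1))).mono_fun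
    ((measurable_bernoulliSpline m).comp (measurable_id.div_const ε)).aestronglyMeasurable
    (ae_of_all _ fun t => ?_)
  simp only [Real.norm_eq_abs]
  exact (abs_bernoulliSpline_le _ _).trans (le_abs_self _)

/-- The floor is constant just to the right of every point, integers included, so the right
derivative exists without exception. At `m = 0` the factor `m` makes the truncated `m - 1` harmless.
-/
theorem hasDerivWithinAt_bernoulliSpline (m : ℕ) (x : ℝ) :
    HasDerivWithinAt (bernoulliSpline m) (m * bernoulliSpline (m - 1) x) (Ioi x) x := by
  have h := ((hasDerivAt_bernoulliFun m (x - ⌊x⌋)).comp_sub_const x ⌊x⌋).hasDerivWithinAt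
    (s := Ioi x)
  refine h.congr_of_eventuallyEq ?_ rfl
  have : ∀ᶠ y in 𝓝[>] x, y ∈ Ioo x (⌊x⌋ + 1) := Ioo_mem_nhdsGT (Int.lt_floor_add_one x)
  filter_upwards [this] with y hy
  have hfl : ⌊y⌋ = ⌊x⌋ := Int.floor_eq_iff.2 ⟨(Int.floor_le x).trans hy.1.le, hy.2⟩
  rw [bernoulliSpline, Int.fract, hfl]

theorem isPrimitiveOn_bernoulliSpline {m : ℕ} (hm : m ≠ 1) {ε : ℝ} (hε : 0 < ε) (a b : ℝ) :
    IsPrimitiveOn (fun t => bernoulliSpline m (t / ε))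
      (fun t => m / ε * bernoulliSpline (m - 1) (t / ε)) a b := by
  refine ⟨(intervalIntegrable_bernoulliSpline_div _ _ _ _).const_mul _, fun x hx => ?_⟩
  -- This form of the fundamental theorem asks only for continuity and right derivatives, so the
  -- lattice points `εk` need no separate treatment.
  rw [intervalIntegral.integral_eq_sub_of_hasDeriv_right (f := fun t => bernoulliSpline m (t / ε))]
  · ring
  · exact ((continuous_bernoulliSpline hm).comp (continuous_id.div_const ε)).continuousOn
  · intro y _
    have h1 : HasDerivWithinAt (fun t : ℝ => t / ε) (1 / ε) (Ioi y) y :=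
      ((hasDerivAt_id y).div_const ε).hasDerivWithinAt
    have h2 := (hasDerivWithinAt_bernoulliSpline m (y / ε)).comp y h1
      (fun t ht => div_lt_div_of_pos_right (mem_Ioi.1 ht) hε)
    refine h2.congr_deriv ?_
    ring
  · exact (intervalIntegrable_bernoulliSpline_div _ _ _ _).const_mul _

/-- The floor of `t/ε` counts the `k ≥ 1` with `εk ≤ t`. These steps are the source of the series in
the formula. -/
theorem bernoulliSpline_one_div_eq {ε t : ℝ} (hε : 0 < ε) {N : ℕ} (ht : 0 ≤ t)
    (htN : t < ε * (N + 1)) : bernoulliSpline 1 (t / ε) = (t / ε - 1 / 2)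
      - ∑ k ∈ Finset.Icc 1 N, (Ici (ε * k)).indicator (fun _ => (1 : ℝ)) t := by
  have h0 : 0 ≤ t / ε := by positivity
  have h1 : ∀ k : ℕ, (Ici (ε * k)).indicator (fun _ => (1 : ℝ)) t
      = if k ≤ ⌊t / ε⌋₊ then 1 else 0 := by
    intro k
    rw [indicator_apply]
    refine if_congr ?_ rfl rfl
    rw [mem_Ici, Nat.le_floor_iff h0, le_div_iff₀ hε, mul_comm]
  have h2 : ⌊t / ε⌋₊ ≤ N := by
    rw [← Nat.lt_succ_iff, Nat.floor_lt h0, div_lt_iff₀ hε]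
    push_cast
    linarith
  simp only [h1]
  rw [← Finset.sum_filter, Finset.sum_const, nsmul_eq_mul, mul_one]
  have h3 : Finset.filter (fun k => k ≤ ⌊t / ε⌋₊) (Finset.Icc 1 N)
      = Finset.Icc 1 ⌊t / ε⌋₊ := by
    ext k
    simp only [Finset.mem_filter, Finset.mem_Icc]
    omega
  rw [h3, Nat.card_Icc, Nat.add_sub_cancel, bernoulliSpline, bernoulliFun_one, Int.fract,
    ← natCast_floor_eq_intCast_floor h0]
  ring

/-- The result of integrating `∫_0^T b_m(t/ε) dg(t)` by parts. -/
noncomputable def splineByParts (m : ℕ) (ε : ℝ) (g : ℝ → ℝ) (T : ℝ) : ℝ :=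
  bernoulliSpline m (T / ε) * g T - bernoulliFun m 0 * g 0
    - (m / ε) * (∫ t in 0..T, g t * bernoulliSpline (m - 1) (t / ε))
    + if m = 1 then ∑ k ∈ Finset.Icc 1 ⌊T / ε⌋₊, g (ε * k) else 0

theorem isPrimitiveOn_div_sub (ε a b c : ℝ) :
    IsPrimitiveOn (fun t => t / ε - c) (fun _ => 1 / ε) a b :=
  .of_hasDerivAt (by fun_prop) (fun x _ => ((hasDerivAt_id x).div_const ε).sub_const c)
    intervalIntegrable_const

theorem mem_Icc_one_floor_div {ε T : ℝ} (hε : 0 < ε) (hT : 0 ≤ T) {k : ℕ}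
    (hk : k ∈ Finset.Icc 1 ⌊T / ε⌋₊) : ε * k ∈ Ioc 0 T := by
  rw [Finset.mem_Icc, Nat.le_floor_iff (by positivity), le_div_iff₀ hε] at hk
  have : (1 : ℝ) ≤ k := by exact_mod_cast hk.1
  exact ⟨by positivity, by linarith [hk.2]⟩

theorem lt_mul_floor_div_add_one {ε T : ℝ} (hε : 0 < ε) : T < ε * (⌊T / ε⌋₊ + 1) := by
  have := Nat.lt_floor_add_one (T / ε)
  rw [div_lt_iff₀ hε] at this
  linarith

/-- The floor hidden in `b_1(T/ε) g(T)` supplies one copy of `g T` for each lattice point in `(0,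
T]`. -/
theorem splineByParts_one {ε T : ℝ} (hε : 0 < ε) (hT : 0 ≤ T) (g : ℝ → ℝ) :
    splineByParts 1 ε g T = ((T / ε - 1 / 2) * g T - (0 / ε - 1 / 2) * g 0
      - ∫ t in 0..T, g t * (1 / ε)) - ∑ k ∈ Finset.Icc 1 ⌊T / ε⌋₊, (g T - g (ε * k)) := by
  have hs : ∑ k ∈ Finset.Icc 1 ⌊T / ε⌋₊, (Ici (ε * k)).indicator (fun _ => (1 : ℝ)) T
      = ⌊T / ε⌋₊ := by
    have h1 : ∀ k ∈ Finset.Icc 1 ⌊T / ε⌋₊, (Ici (ε * (k : ℝ))).indicator (fun _ => (1 : ℝ)) T = 1 :=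
      fun k hk => indicator_of_mem (mem_Ici.2 (mem_Icc_one_floor_div hε hT hk).2) _
    rw [Finset.sum_congr rfl h1]
    simp
  rw [splineByParts, if_pos rfl, bernoulliSpline_one_div_eq hε hT (lt_mul_floor_div_add_one hε), hs,
    intervalIntegral.integral_mul_const, Finset.sum_sub_distrib, Finset.sum_const, Nat.card_Icc]
  simp only [Nat.sub_self, bernoulliSpline_zero_left, bernoulliFun_one, mul_one, nsmul_eq_mul]
  push_cast
  ring

theorem splineByParts_of_ne_one {m : ℕ} (hm : m ≠ 1) (ε : ℝ) (g : ℝ → ℝ) (T : ℝ) :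
    splineByParts m ε g T = bernoulliSpline m (T / ε) * g T - bernoulliSpline m (0 / ε) * g 0
      - ∫ t in 0..T, g t * (m / ε * bernoulliSpline (m - 1) (t / ε)) := by
  rw [splineByParts, if_neg hm, ← intervalIntegral.integral_const_mul, zero_div,
    ← Nat.cast_zero (R := ℝ), bernoulliSpline_natCast, Nat.cast_zero, add_zero]
  congr 2
  ext t
  ring

theorem hasRSIntegral_bernoulliSpline (m : ℕ) {ε T : ℝ} (hε : 0 < ε) (hT : 0 ≤ T) {g : ℝ → ℝ}
    (hg : ContinuousOn g (Icc 0 T)) :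
    HasRSIntegral (fun t => bernoulliSpline m (t / ε)) g 0 T (splineByParts m ε g T) := by
  by_cases hm : m = 1
  · subst hm
    have h1 := (isPrimitiveOn_div_sub ε 0 T (1 / 2)).hasRSIntegral hT hg
    have h2 := HasRSIntegral.sum (Finset.Icc 1 ⌊T / ε⌋₊) hT fun k hk =>
      hasRSIntegral_indicator_Ici (mem_Icc_one_floor_div hε hT hk) hg
    rw [splineByParts_one hε hT]
    refine (h1.sub h2).congr (fun t ht => ?_) fun _ _ => rfl
    exact bernoulliSpline_one_div_eq hε ht.1 (ht.2.trans_lt (lt_mul_floor_div_add_one hε))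
  · rw [splineByParts_of_ne_one hm]
    exact (isPrimitiveOn_bernoulliSpline hm hε 0 T).hasRSIntegral hT hg

/-- When the integrator has a density, the Lebesgue integral takes the same value as the Stieltjes
integral. This turns the integral inside `splineByParts (k + 2)` into `splineByParts (k + 1)` of the
previous derivative, which is the recurrence; it also gives access to the oscillation when `F^{(n)}`
is absolutely continuous. -/
theorem integral_bernoulliSpline_mul (m : ℕ) {ε T : ℝ} (hε : 0 < ε) (hT : 0 ≤ T) {g g' : ℝ → ℝ}
    (hg : IsPrimitiveOn g g' 0 T) :
    ∫ t in 0..T, bernoulliSpline m (t / ε) * g' t = splineByParts m ε g T := by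
  by_cases hm : m = 1
  · subst hm
    have hi : IntervalIntegrable (fun t => (t / ε - 1 / 2) * g' t) volume 0 T :=
      hg.1.continuousOn_mul (by fun_prop)
    have hind : ∀ k : ℕ, (fun t => (Ici (ε * k)).indicator (fun _ => (1 : ℝ)) t * g' t)
        = (Ici (ε * k)).indicator g' := by
      intro k
      ext t
      by_cases ht : t ∈ Ici (ε * k) <;> simp [ht]
    have hik : ∀ k : ℕ, IntervalIntegrable
        (fun t => (Ici (ε * k)).indicator (fun _ => (1 : ℝ)) t * g' t) volume 0 T := by
      intro k
      rw [hind]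
      exact ⟨hg.1.1.indicator measurableSet_Ici, hg.1.2.indicator measurableSet_Ici⟩
    have hval : ∀ k ∈ Finset.Icc 1 ⌊T / ε⌋₊,
        ∫ t in 0..T, (Ici (ε * k)).indicator (fun _ => (1 : ℝ)) t * g' t = g T - g (ε * k) := by
      intro k hk
      have hkm := mem_Icc_one_floor_div hε hT hk
      rw [hind, ← hg.integral_eq ⟨hkm.1.le, hkm.2⟩ ⟨hT, le_rfl⟩,
        intervalIntegral.integral_of_le hT, setIntegral_indicator measurableSet_Ici,
        intervalIntegral.integral_of_le hkm.2, ← integral_Icc_eq_integral_Ioc]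
      congr 2
      ext t
      simp only [mem_inter_iff, mem_Ioc, mem_Ici, mem_Icc]
      exact ⟨fun h => ⟨h.2, h.1.2⟩, fun h => ⟨⟨hkm.1.trans_le h.1, h.2⟩, h.1⟩⟩
    have hsum : IntervalIntegrable (fun t => ∑ k ∈ Finset.Icc 1 ⌊T / ε⌋₊,
        (Ici (ε * k)).indicator (fun _ => (1 : ℝ)) t * g' t) volume 0 T := by
      convert! IntervalIntegrable.sum (Finset.Icc 1 ⌊T / ε⌋₊) fun k _ => hik k using 1
      ext t
      rw [Finset.sum_apply]
    rw [splineByParts_one hε hT, ← (isPrimitiveOn_div_sub ε 0 T (1 / 2)).integral_mul_eq hT hg,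
      ← Finset.sum_congr rfl hval, ← intervalIntegral.integral_finsetSum fun k _ => hik k,
      ← intervalIntegral.integral_sub hi hsum]
    · refine intervalIntegral.integral_congr fun t ht => ?_
      rw [uIcc_of_le hT] at ht
      rw [bernoulliSpline_one_div_eq hε ht.1 (ht.2.trans_lt (lt_mul_floor_div_add_one hε)),
        sub_mul, Finset.sum_mul]
  · rw [splineByParts_of_ne_one hm]
    exact (isPrimitiveOn_bernoulliSpline hm hε 0 T).integral_mul_eq hT hg

/-! ### The Euler–Maclaurin formula with remainder -/

/-- Solution of the recurrence produced by repeated integration by parts. -/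
theorem sum_eulerMaclaurin_of_recurrence {ε : ℝ} (hε : ε ≠ 0) (H β : ℕ → ℝ) (n : ℕ)
    (h : ∀ k < n, H (k + 1) = β (k + 1) - ((k : ℝ) + 2) / ε * H k) :
    ∑ k ∈ Finset.range (n + 1), (-1) ^ k * ε ^ k / (Nat.factorial (k + 1) : ℝ) * β k
      = β 0 - H 0 + (-1) ^ n * ε ^ n / (Nat.factorial (n + 1) : ℝ) * H n := by
  induction n with
  | zero => simp
  | succ n ih =>
    rw [Finset.sum_range_succ, ih fun k hk => h k (by omega), h n (by omega),
      Nat.factorial_succ (n + 1)]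
    have h1 : ((n + 1).factorial : ℝ) ≠ 0 := by positivity
    have h2 : (n : ℝ) + 2 ≠ 0 := by positivity
    have h3 : ((n + 1 + 1 : ℕ) : ℝ) = n + 2 := by push_cast; ring
    rw [Nat.cast_mul, h3]
    field_simp
    ring

/-- The result of integrating `∫_0^1 B_m(-u+ut) dD(tεu)` by parts. -/
noncomputable def headByParts (m : ℕ) (D : ℝ → ℝ) (ε u : ℝ) : ℝ :=
  bernoulliFun m 0 * D (ε * u) - bernoulliFun m (-u) * D 0
    - ∫ t in (0 : ℝ)..1, D (t * ε * u) * (m * bernoulliFun (m - 1) (-u + u * t) * u)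

theorem isPrimitiveOn_bernoulliFun_affine (m : ℕ) (u a b : ℝ) :
    IsPrimitiveOn (fun t => bernoulliFun m (-u + u * t))
      (fun t => m * bernoulliFun (m - 1) (-u + u * t) * u) a b := by
  refine .of_hasDerivAt ?_ (fun x _ => ?_) ?_
  · exact ((continuous_bernoulliFun m).comp (by fun_prop)).continuousOn
  · have h1 : HasDerivAt (fun t : ℝ => -u + u * t) u x := by
      simpa using ((hasDerivAt_id x).const_mul u).const_add (-u)
    exact (hasDerivAt_bernoulliFun m (-u + u * x)).comp x h1
  · exact ((continuous_const.mul ((continuous_bernoulliFun (m - 1)).comp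
      (by fun_prop))).mul_const u).intervalIntegrable _ _

theorem mul_mul_mem_Ici {q ε u t : ℝ} (hq : q ≤ 0) (hu : q ≤ ε * u) (ht : t ∈ Icc (0 : ℝ) 1) :
    t * ε * u ∈ Ici q := by
  rw [mem_Ici, mul_assoc]
  nlinarith [ht.1, ht.2]

theorem mapsTo_add_Ici {q ε u T : ℝ} (hu : q ≤ ε * u) :
    MapsTo (fun t => t + ε * u) (Icc 0 T) (Ici q) := fun t ht => by
  simp only [mem_Ici]
  linarith [ht.1]

/-! ### Existence and size of the two integrals in the remainder -/

section Head

variable {q ε u : ℝ} {D : ℝ → ℝ}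

theorem continuousOn_head (hq : q ≤ 0) (hu : q ≤ ε * u) (hD : ContinuousOn D (Ici q)) :
    ContinuousOn (fun t => D (t * ε * u)) (Icc 0 1) :=
  hD.comp (by fun_prop) fun _ ht => mul_mul_mem_Ici hq hu ht

theorem headByParts_eq (m : ℕ) (D : ℝ → ℝ) (ε u : ℝ) :
    headByParts m D ε u = bernoulliFun m (-u + u * 1) * D (1 * ε * u)
      - bernoulliFun m (-u + u * 0) * D (0 * ε * u)
      - ∫ t in (0 : ℝ)..1, D (t * ε * u) * (m * bernoulliFun (m - 1) (-u + u * t) * u) := by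
  simp [headByParts]

theorem hasRSIntegral_head (m : ℕ) (hq : q ≤ 0) (hu : q ≤ ε * u) (hD : ContinuousOn D (Ici q)) :
    HasRSIntegral (fun t => bernoulliFun m (-u + u * t)) (fun t => D (t * ε * u)) 0 1
      (headByParts m D ε u) := by
  rw [headByParts_eq]
  exact (isPrimitiveOn_bernoulliFun_affine m u 0 1).hasRSIntegral zero_le_one
    (continuousOn_head hq hu hD)

/-- The substitution `t ↦ tεu` is monotone or antitone according to the sign of `εu`, and neither
kind of substitution increases variation. -/
theorem eVariationOn_head_le (D : ℝ → ℝ) (ε u : ℝ) :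
    eVariationOn (fun t => D (t * ε * u)) (Icc 0 1) ≤ eVariationOn D (uIcc 0 (ε * u)) := by
  have hmaps : MapsTo (fun t : ℝ => t * ε * u) (Icc 0 1) (uIcc 0 (ε * u)) := by
    intro t ht
    simp only [mul_assoc]
    rcases le_total 0 (ε * u) with h | h
    · rw [uIcc_of_le h]
      exact ⟨mul_nonneg ht.1 h, mul_le_of_le_one_left h ht.2⟩
    · rw [uIcc_of_ge h]
      exact ⟨by nlinarith [ht.1, ht.2], mul_nonpos_of_nonneg_of_nonpos ht.1 h⟩
  rcases le_total 0 (ε * u) with h | h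
  · refine eVariationOn.comp_le_of_monotoneOn D _ (fun s _ t _ hst => ?_) hmaps
    simp only [mul_assoc]
    exact mul_le_mul_of_nonneg_right hst h
  · refine eVariationOn.comp_le_of_antitoneOn D _ (fun s _ t _ hst => ?_) hmaps
    simp only [mul_assoc]
    exact mul_le_mul_of_nonpos_right hst h

theorem uIcc_zero_subset_Ici (hq : q ≤ 0) (hu : q ≤ ε * u) : uIcc 0 (ε * u) ⊆ Ici q :=
  ordConnected_Ici.uIcc_subset hq hu

theorem abs_headByParts_le (m : ℕ) (hq : q ≤ 0) (hu : q ≤ ε * u) (hD : ContinuousOn D (Ici q))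
    (hv : BoundedVariationOn D (Ici q)) :
    |headByParts m D ε u| ≤ supAbs (bernoulliFun m) (uIcc (-u) 0)
      * (eVariationOn D (uIcc 0 (ε * u))).toReal := by
  have hv' := hv.mono (uIcc_zero_subset_Ici hq hu)
  have hle := eVariationOn_head_le D ε u
  refine ((hasRSIntegral_head m hq hu hD).abs_le
    (M := supAbs (bernoulliFun m) (uIcc (-u) 0)) (fun t ht => ?_) (ne_top_of_le_ne_top hv' hle)).trans
    (mul_le_mul_of_nonneg_left (ENNReal.toReal_mono hv' hle) (supAbs_nonneg _ _))
  refine abs_le_supAbs_of_isCompact isCompact_uIcc (continuous_bernoulliFun m).continuousOn ?_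
  rcases le_total 0 u with h | h
  · rw [uIcc_of_le (by linarith)]
    constructor <;> nlinarith [ht.1, ht.2]
  · rw [uIcc_of_ge (by linarith)]
    constructor <;> nlinarith [ht.1, ht.2]

theorem eVariationOn_comp_add_Ici_le (D : ℝ → ℝ) (c T : ℝ) :
    eVariationOn (fun t => D (t + c)) (Ici T) ≤ eVariationOn D (Ici (T + c)) :=
  eVariationOn.comp_le_of_monotoneOn D (fun t => t + c) (fun _ _ _ _ h => by simpa using h)
    fun _ ht => by simpa using ht

theorem splineByParts_zero_right (m : ℕ) (ε : ℝ) (g : ℝ → ℝ) : splineByParts m ε g 0 = 0 := by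
  have h0 : bernoulliSpline m 0 = bernoulliFun m 0 := by
    simpa using bernoulliSpline_natCast m 0
  simp [splineByParts, h0]

/-- The remainder as a sum of two integrals, the improper one with an estimate for its tails. -/
theorem exists_emRemainder_eq (n : ℕ) (hq : q ≤ 0) (hε : 0 < ε) (hu : q ≤ ε * u)
    (hD : ContinuousOn D (Ici q)) (hv : BoundedVariationOn D (Ici q)) :
    EMRemainderExists n D ε u ∧ ∃ I,
      Tendsto (splineByParts (n + 1) ε fun t => D (t + ε * u)) atTop (𝓝 I) ∧
      emRemainder n D ε u = I + headByParts (n + 1) D ε u ∧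
      ∀ T, 0 ≤ T → |I - splineByParts (n + 1) ε (fun t => D (t + ε * u)) T| ≤
        supAbs (bernoulliSpline (n + 1)) (Icc 0 1) * (eVariationOn D (Ici (T + ε * u))).toReal := by
  have hvT : ∀ T, 0 ≤ T → BoundedVariationOn D (Ici (T + ε * u)) := fun T hT =>
    hv.mono (Ici_subset_Ici.2 (by linarith))
  obtain ⟨I, hI, hJ, hT⟩ := exists_hasImproperRSIntegral
    (f := fun t => bernoulliSpline (n + 1) (t / ε)) (g := fun t => D (t + ε * u))
    (fun T hT => hasRSIntegral_bernoulliSpline (n + 1) hε hT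
      (hD.comp (by fun_prop) (mapsTo_add_Ici hu)))
    (fun x => abs_bernoulliSpline_le (n + 1) (x / ε))
    (ne_top_of_le_ne_top (hvT 0 le_rfl) (eVariationOn_comp_add_Ici_le D (ε * u) 0))
  have hH := hasRSIntegral_head (n + 1) hq hu hD
  refine ⟨⟨⟨I, hI⟩, _, hH⟩, I, hJ, ?_, fun T hT0 => (hT T hT0).trans ?_⟩
  · rw [emRemainder, hI.improperRSIntegral_eq, hH.rsIntegral_eq]
  · exact mul_le_mul_of_nonneg_left (ENNReal.toReal_mono (hvT T hT0)
      (eVariationOn_comp_add_Ici_le D (ε * u) T)) (supAbs_nonneg _ _)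

theorem abs_emRemainder_le (n : ℕ) (hq : q ≤ 0) (hε : 0 < ε) (hu : q ≤ ε * u)
    (hD : ContinuousOn D (Ici q)) (hv : BoundedVariationOn D (Ici q)) :
    |emRemainder n D ε u| ≤
      supAbs (bernoulliSpline (n + 1)) (Icc 0 1) * (eVariationOn D (Ici (ε * u))).toReal
      + supAbs (bernoulliFun (n + 1)) (uIcc (-u) 0)
        * (eVariationOn D (uIcc 0 (ε * u))).toReal := by
  obtain ⟨-, I, -, hL, hT⟩ := exists_emRemainder_eq n hq hε hu hD hv
  -- At `T = 0` the proper integral vanishes, so the tail estimate bounds the whole improper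
  -- integral.
  have h0 := hT 0 le_rfl
  rw [splineByParts_zero_right, sub_zero, zero_add] at h0
  rw [hL]
  exact (abs_add_le _ _).trans (add_le_add h0 (abs_headByParts_le _ hq hu hD hv))

end Head

/-! ### Euler–Maclaurin for partial sums and the passage to the limit -/

section Formula

variable {q ε u : ℝ} {F : ℝ → ℝ} {n : ℕ}

theorem continuousOn_iteratedDerivWithin_Ici (hF : ContDiffOn ℝ n F (Ici q)) {k : ℕ}
    (hk : k ≤ n) : ContinuousOn (iteratedDerivWithin k F (Ici q)) (Ici q) :=
  hF.continuousOn_iteratedDerivWithin (by exact_mod_cast hk) (uniqueDiffOn_Ici q)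

/-- The one-sided derivative at `q` causes no trouble: it pulls back along `φ` to a derivative
within `Icc a b`, which is two-sided at interior points even if `φ` is constantly `q` there. The two
uses are `t + εu` and `tεu`. -/
theorem isPrimitiveOn_iteratedDerivWithin_comp (hF : ContDiffOn ℝ n F (Ici q)) {k : ℕ}
    (hk : k < n) {φ : ℝ → ℝ} {a b c : ℝ} (hφ : ∀ t, HasDerivAt φ c t)
    (hmaps : MapsTo φ (Icc a b) (Ici q)) (hab : a ≤ b) :
    IsPrimitiveOn (fun t => iteratedDerivWithin k F (Ici q) (φ t))
      (fun t => iteratedDerivWithin (k + 1) F (Ici q) (φ t) * c) a b := by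
  have hφc : Continuous φ := continuous_iff_continuousAt.2 fun t => (hφ t).continuousAt
  refine .of_hasDerivAt ?_ (fun x hx => ?_) ?_
  · exact (continuousOn_iteratedDerivWithin_Ici hF hk.le).comp hφc.continuousOn hmaps
  · have h1 := (hF.differentiableOn_iteratedDerivWithin (m := k) (by exact_mod_cast hk)
      (uniqueDiffOn_Ici q) (φ x) (hmaps (Ioo_subset_Icc_self hx))).hasDerivWithinAt
    rw [← iteratedDerivWithin_succ] at h1
    exact (h1.comp x (hφ x).hasDerivWithinAt hmaps).hasDerivAt (Icc_mem_nhds hx.1 hx.2)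
  · refine ContinuousOn.intervalIntegrable ?_
    rw [uIcc_of_le hab]
    exact ((continuousOn_iteratedDerivWithin_Ici hF hk).comp hφc.continuousOn hmaps).mul
      continuousOn_const

/-- Stopping at `T = εp` makes `T/ε` an integer, so both ends carry the same weight `B_{k+1}(0)`. -/
theorem sum_tail_eq (hF : ContDiffOn ℝ n F (Ici q)) (hε : 0 < ε) (hu : q ≤ ε * u) (p : ℕ) :
    ∑ k ∈ Finset.Icc 1 p, F (ε * k + ε * u) =
      1 / ε * (∫ t in 0..ε * p, F (t + ε * u))
      + (∑ k ∈ Finset.range (n + 1), (-1) ^ k * ε ^ k / (Nat.factorial (k + 1) : ℝ)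
        * (bernoulliFun (k + 1) 0 * (iteratedDerivWithin k F (Ici q) (ε * u)
          - iteratedDerivWithin k F (Ici q) (ε * p + ε * u))))
      + (-1) ^ n * ε ^ n / (Nat.factorial (n + 1) : ℝ) * splineByParts (n + 1) ε
        (fun t => iteratedDerivWithin n F (Ici q) (t + ε * u)) (ε * p) := by
  set g : ℕ → ℝ → ℝ := fun k t => iteratedDerivWithin k F (Ici q) (t + ε * u)
  have hT : 0 ≤ ε * p := by positivity
  have hdiv : ε * p / ε = p := by field_simp
  have hprim : ∀ k < n, IsPrimitiveOn (g k) (g (k + 1)) 0 (ε * p) := fun k hk => by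
    simpa using isPrimitiveOn_iteratedDerivWithin_comp hF hk
      (φ := fun t => t + ε * u) (c := 1) (fun t => (hasDerivAt_id t).add_const _)
      (mapsTo_add_Ici hu) hT
  have key := sum_eulerMaclaurin_of_recurrence hε.ne'
    (fun k => splineByParts (k + 1) ε (g k) (ε * p))
    (fun k => bernoulliFun (k + 1) 0 * (g k (ε * p) - g k 0)) n fun k hk => by
      rw [← integral_bernoulliSpline_mul (k + 1) hε hT (hprim k hk), splineByParts, hdiv,
        bernoulliSpline_natCast, if_neg (by omega), Nat.add_sub_cancel]
      simp only [mul_comm (bernoulliSpline _ _)]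
      push_cast
      ring
  -- Only the order-one kernel has jumps, so the sum over lattice points enters through the initial
  -- term of the recurrence.
  have h0 : splineByParts (0 + 1) ε (g 0) (ε * p) = bernoulliFun (0 + 1) 0 * (g 0 (ε * p) - g 0 0)
      - 1 / ε * (∫ t in 0..ε * p, F (t + ε * u)) + ∑ k ∈ Finset.Icc 1 p, F (ε * k + ε * u) := by
    rw [splineByParts, hdiv, bernoulliSpline_natCast, if_pos rfl, Nat.floor_natCast]
    simp only [g, iteratedDerivWithin_zero, bernoulliSpline_zero_left, zero_add, Nat.sub_self,
      mul_one, Nat.cast_one]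
    ring
  have hneg : ∑ k ∈ Finset.range (n + 1), (-1) ^ k * ε ^ k / (Nat.factorial (k + 1) : ℝ)
        * (bernoulliFun (k + 1) 0 * (iteratedDerivWithin k F (Ici q) (ε * u)
          - iteratedDerivWithin k F (Ici q) (ε * p + ε * u)))
      = - ∑ k ∈ Finset.range (n + 1), (-1) ^ k * ε ^ k / (Nat.factorial (k + 1) : ℝ)
        * (bernoulliFun (k + 1) 0 * (g k (ε * p) - g k 0)) := by
    rw [← Finset.sum_neg_distrib]
    refine Finset.sum_congr rfl fun k _ => ?_
    simp only [g, zero_add]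
    ring
  rw [hneg, key, h0]
  ring

/-- Ordinary repeated integration by parts between `0` and `εu`; the polynomial kernel has no jumps,
so no sum appears. It moves the boundary terms of `sum_tail_eq` to the origin. -/
theorem sum_head_eq (hF : ContDiffOn ℝ n F (Ici q)) (hq : q ≤ 0) (hε : 0 < ε) (hu : q ≤ ε * u) :
    ∑ k ∈ Finset.range (n + 1), (-1) ^ k * ε ^ k / (Nat.factorial (k + 1) : ℝ)
        * (bernoulliFun (k + 1) 0 * iteratedDerivWithin k F (Ici q) (ε * u)
          - bernoulliFun (k + 1) (-u) * iteratedDerivWithin k F (Ici q) 0)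
      = 1 / ε * (∫ t in 0..ε * u, F t) + (-1) ^ n * ε ^ n / (Nat.factorial (n + 1) : ℝ)
        * headByParts (n + 1) (iteratedDerivWithin n F (Ici q)) ε u := by
  have hprim : ∀ k < n, IsPrimitiveOn (fun t => iteratedDerivWithin k F (Ici q) (t * ε * u))
      (fun t => iteratedDerivWithin (k + 1) F (Ici q) (t * ε * u) * (ε * u)) 0 1 := fun k hk => by
    refine isPrimitiveOn_iteratedDerivWithin_comp hF hk (φ := fun t => t * ε * u) (fun t => ?_)
      (fun t ht => mul_mul_mem_Ici hq hu ht) zero_le_one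
    simpa using ((hasDerivAt_id t).mul_const ε).mul_const u
  rw [sum_eulerMaclaurin_of_recurrence hε.ne'
    (fun k => headByParts (k + 1) (iteratedDerivWithin k F (Ici q)) ε u)]
  · have : ∫ t in (0 : ℝ)..1, F (t * ε * u) * (((0 + 1 : ℕ) : ℝ) *
        bernoulliFun (0 + 1 - 1) (-u + u * t) * u) = 1 / ε * ∫ t in 0..ε * u, F t := by
      simp only [zero_add, Nat.sub_self, bernoulliFun_zero, Nat.cast_one, mul_one, one_mul,
        intervalIntegral.integral_mul_const, mul_assoc]
      -- Keeping the factor `εu` on the left makes the change of variables valid for `u = 0` too.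
      have h := intervalIntegral.smul_integral_comp_mul_right (a := 0) (b := 1) F (ε * u)
      rw [zero_mul, one_mul, smul_eq_mul] at h
      rw [← h]
      generalize ∫ t in (0 : ℝ)..1, F (t * (ε * u)) = A
      field_simp
    rw [headByParts, iteratedDerivWithin_zero, this]
    ring
  · intro k hk
    have h := (isPrimitiveOn_bernoulliFun_affine (k + 1) u 0 1).integral_mul_eq zero_le_one
      (hprim k hk)
    rw [← headByParts_eq] at h
    rw [← h, headByParts, ← intervalIntegral.integral_const_mul]
    congr 1
    refine intervalIntegral.integral_congr fun t _ => ?_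
    simp only [Nat.add_sub_cancel]
    push_cast
    field_simp
    ring

theorem tendsto_sum_eulerMaclaurin (hq : q ≤ 0) (hF : ContDiffOn ℝ n F (Ici q))
    (hint : IntegrableOn F (Ici q))
    (hv : BoundedVariationOn (iteratedDerivWithin n F (Ici q)) (Ici q))
    (hlim : ∀ k ≤ n, Tendsto (iteratedDerivWithin k F (Ici q)) atTop (𝓝 0))
    (hε : 0 < ε) (hu : q ≤ ε * u) :
    Tendsto (fun p : ℕ => ∑ k ∈ Finset.Icc 1 p, F (ε * k + ε * u)) atTop
      (𝓝 ((1 / ε) * (∫ t in Ioi (0 : ℝ), F t)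
        + (∑ k ∈ Finset.range (n + 1), (-1) ^ k * ε ^ k / (Nat.factorial (k + 1) : ℝ)
            * bernoulliFun (k + 1) (-u) * iteratedDerivWithin k F (Ici q) 0)
        + (-1) ^ n * ε ^ n / (Nat.factorial (n + 1) : ℝ)
            * emRemainder n (iteratedDerivWithin n F (Ici q)) ε u)) := by
  obtain ⟨-, I, hI, hL, -⟩ := exists_emRemainder_eq n hq hε hu
    (continuousOn_iteratedDerivWithin_Ici hF le_rfl) hv
  have hp : Tendsto (fun p : ℕ => ε * (p : ℝ)) atTop atTop :=
    tendsto_natCast_atTop_atTop.const_mul_atTop hε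
  have hp' : Tendsto (fun p : ℕ => ε * (p : ℝ) + ε * u) atTop atTop :=
    tendsto_atTop_add_const_right _ _ hp
  have hii : ∀ {a b : ℝ}, q ≤ a → q ≤ b → IntervalIntegrable F volume a b := fun ha hb =>
    (hF.continuousOn.mono (ordConnected_Ici.uIcc_subset ha hb)).intervalIntegrable
  have hint0 : Tendsto (fun p : ℕ => ∫ t in 0..ε * p, F (t + ε * u)) atTop
      (𝓝 ((∫ t in Ioi (0 : ℝ), F t) - ∫ t in 0..ε * u, F t)) := by
    have h1 := intervalIntegral_tendsto_integral_Ioi 0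
      (hint.mono_set (Ioi_subset_Ici hq)) hp'
    refine (h1.sub_const (∫ t in 0..ε * u, F t)).congr fun p => ?_
    rw [intervalIntegral.integral_comp_add_right, zero_add, sub_eq_iff_eq_add',
      intervalIntegral.integral_add_adjacent_intervals (hii hq hu) (hii hu _)]
    have : 0 ≤ ε * (p : ℝ) := by positivity
    linarith
  have hterm : Tendsto (fun p : ℕ => ∑ k ∈ Finset.range (n + 1),
      (-1) ^ k * ε ^ k / (Nat.factorial (k + 1) : ℝ)
        * (bernoulliFun (k + 1) 0 * (iteratedDerivWithin k F (Ici q) (ε * u)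
          - iteratedDerivWithin k F (Ici q) (ε * p + ε * u)))) atTop
      (𝓝 (∑ k ∈ Finset.range (n + 1), (-1) ^ k * ε ^ k / (Nat.factorial (k + 1) : ℝ)
        * (bernoulliFun (k + 1) 0 * (iteratedDerivWithin k F (Ici q) (ε * u) - 0)))) := by
    refine tendsto_finsetSum _ fun k hk => ?_
    rw [Finset.mem_range, Nat.lt_succ_iff] at hk
    exact ((((hlim k hk).comp hp').const_sub _).const_mul _).const_mul _
  have htot := ((hint0.const_mul (1 / ε)).add hterm).add
    ((hI.comp hp).const_mul ((-1) ^ n * ε ^ n / (Nat.factorial (n + 1) : ℝ)))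
  have hhead := sum_head_eq hF hq hε hu
  simp only [mul_sub, Finset.sum_sub_distrib] at hhead
  convert! htot.congr fun p => (sum_tail_eq hF hε hu p).symm using 2
  rw [hL]
  simp only [sub_zero, mul_assoc] at hhead ⊢
  -- The head identity cancels the boundary values at `εu` and the integral of `F` from `0` to `εu`.
  linear_combination -hhead

end Formula

/-! ### Vanishing of the remainder for absolutely continuous derivatives -/

/-- Density of smooth compactly supported functions in `L¹`. Compact support bounds `φ` and its
derivative on all of `ℝ`, so one `K` serves every translate of `φ`. -/
theorem exists_contDiff_integral_abs_sub_le {h : ℝ → ℝ} {a b : ℝ} (hab : a ≤ b)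
    (hh : IntervalIntegrable h volume a b) {η : ℝ} (hη : 0 < η) :
    ∃ φ : ℝ → ℝ, ContDiff ℝ 1 φ ∧ (∃ K, ∀ x, |φ x| ≤ K ∧ |deriv φ x| ≤ K) ∧
      ∫ t in a..b, |h t - φ t| ≤ η := by
  rw [intervalIntegrable_iff_integrableOn_Ioc_of_le hab] at hh
  obtain ⟨φ, hφc, hφ, hle⟩ := MemLp.exist_eLpNorm_sub_le ENNReal.one_ne_top le_rfl
    (memLp_one_iff_integrable.2 hh) hη
  have hφ1 : ContDiff ℝ 1 φ := hφ.of_le (by exact_mod_cast le_top)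
  have hd : Continuous (deriv φ) := hφ1.continuous_deriv le_rfl
  obtain ⟨K₁, hK₁⟩ := hφc.exists_bound_of_continuous hφ1.continuous
  obtain ⟨K₂, hK₂⟩ := hφc.deriv.exists_bound_of_continuous hd
  refine ⟨φ, hφ1, ⟨max K₁ K₂, fun x => ⟨(hK₁ x).trans (le_max_left _ _),
    (hK₂ x).trans (le_max_right _ _)⟩⟩, ?_⟩
  have hi : IntegrableOn (h - φ) (Ioc a b) volume :=
    hh.sub (hφ1.continuous.integrableOn_Ioc)
  rw [intervalIntegral.integral_of_le hab]
  have e := integral_norm_eq_lintegral_enorm hi.aestronglyMeasurable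
  rw [eLpNorm_one_eq_lintegral_enorm] at hle
  have e' : ∫ t in Ioc a b, |h t - φ t| = (∫⁻ t in Ioc a b, ‖(h - φ) t‖ₑ).toReal := e
  rw [e']
  exact ENNReal.toReal_le_of_le_ofReal hη.le hle

/-- Integrals of a bounded periodic function against a smooth weight are `O(ε)`. -/
theorem abs_integral_bernoulliSpline_mul_le (m : ℕ) (hm : m ≠ 0) {ε T K : ℝ} (hε : 0 < ε)
    (hT : 0 ≤ T) {φ : ℝ → ℝ} (hφ : ContDiff ℝ 1 φ) (hK : ∀ x, |φ x| ≤ K ∧ |deriv φ x| ≤ K) :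
    |∫ t in 0..T, bernoulliSpline m (t / ε) * φ t| ≤
      ε * (supAbs (bernoulliSpline (m + 1)) (Icc 0 1) * (K * (2 + T))) := by
  set S := supAbs (bernoulliSpline (m + 1)) (Icc 0 1)
  have hS0 : 0 ≤ S := supAbs_nonneg _ _
  have hK0 : 0 ≤ K := (abs_nonneg _).trans (hK 0).1
  have hprim : IsPrimitiveOn φ (deriv φ) 0 T := .of_hasDerivAt hφ.continuous.continuousOn
    (fun x _ => (hφ.differentiable one_ne_zero x).hasDerivAt)
    ((hφ.continuous_deriv le_rfl).intervalIntegrable _ _)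
  have h := integral_bernoulliSpline_mul (m + 1) hε hT hprim
  have h0 : bernoulliFun (m + 1) 0 = bernoulliSpline (m + 1) 0 := by
    simpa using (bernoulliSpline_natCast (m + 1) 0).symm
  -- Since `m ≠ 0`, the kernel `b_{m+1}` is not the sawtooth and no jump sum arises.
  rw [splineByParts, if_neg (by omega), Nat.add_sub_cancel, add_zero, h0] at h
  simp only [mul_comm (φ _) (bernoulliSpline m _)] at h
  set A := ∫ t in 0..T, bernoulliSpline m (t / ε) * φ t
  have b1 : |∫ t in 0..T, bernoulliSpline (m + 1) (t / ε) * deriv φ t| ≤ S * K * T := by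
    have := intervalIntegral.norm_integral_le_of_norm_le_const (a := 0) (b := T) (C := S * K)
      (f := fun t => bernoulliSpline (m + 1) (t / ε) * deriv φ t) fun t _ => by
        rw [norm_mul]
        exact mul_le_mul (abs_bernoulliSpline_le _ _) (hK t).2 (abs_nonneg _) hS0
    rwa [sub_zero, abs_of_nonneg hT] at this
  have b2 : ∀ x y, |bernoulliSpline (m + 1) x * φ y| ≤ S * K := fun x y => by
    rw [abs_mul]
    exact mul_le_mul (abs_bernoulliSpline_le _ _) (hK y).1 (abs_nonneg _) hS0
  have c1 := b2 (T / ε) T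
  have c2 := b2 0 0
  have hA : ((m + 1 : ℕ) : ℝ) * A = ε * (bernoulliSpline (m + 1) (T / ε) * φ T
      - bernoulliSpline (m + 1) 0 * φ 0
      - ∫ t in 0..T, bernoulliSpline (m + 1) (t / ε) * deriv φ t) := by
    rw [h]
    field_simp
    ring
  -- The `2` counts the two boundary terms, the `T` the integral of `b_{m+1} φ'`.
  have hB : |((m + 1 : ℕ) : ℝ) * A| ≤ ε * (S * (K * (2 + T))) := by
    rw [hA, abs_mul, abs_of_pos hε]
    refine mul_le_mul_of_nonneg_left ?_ hε.le
    rw [abs_le] at *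
    constructor <;> linarith [b1.1, b1.2, c1.1, c1.2, c2.1, c2.2]
  refine le_trans ?_ hB
  rw [abs_mul, Nat.abs_cast]
  refine le_mul_of_one_le_left (abs_nonneg _) ?_
  exact_mod_cast Nat.le_add_left 1 m

/-- Replacing `deriv D` by `φ` costs the sup of the kernel times an `L¹` distance; the rest is
`O(ε)`. Taking that distance over all of `[q, T]` removes its dependence on the shift `c`. -/
theorem abs_splineByParts_le (m : ℕ) (hm : m ≠ 0) {q ε c T K : ℝ} (hε : 0 < ε) (hc : q ≤ c)
    (hcT : c ≤ T) {D φ : ℝ → ℝ} (hD : AbsolutelyContinuousOnInterval D q T)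
    (hφ : ContDiff ℝ 1 φ) (hK : ∀ x, |φ x| ≤ K ∧ |deriv φ x| ≤ K) :
    |splineByParts m ε (fun t => D (t + c)) (T - c)| ≤
      supAbs (bernoulliSpline m) (Icc 0 1) * (∫ t in q..T, |deriv D t - φ t|)
      + ε * (supAbs (bernoulliSpline (m + 1)) (Icc 0 1) * (K * (2 + (T - c)))) := by
  have hqT : q ≤ T := hc.trans hcT
  have hT : 0 ≤ T - c := by linarith
  have hprim : IsPrimitiveOn (fun t => D (t + c)) (fun t => deriv D (t + c)) 0 (T - c) := by
    refine IsPrimitiveOn.comp_add_right ?_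
    rw [zero_add, sub_add_cancel]
    exact (IsPrimitiveOn.of_absolutelyContinuousOnInterval hqT hD).mono hc hcT le_rfl
  have hdiff : IntervalIntegrable (fun t => |deriv D t - φ t|) volume q T :=
    (hD.intervalIntegrable_deriv.sub (hφ.continuous.intervalIntegrable _ _)).abs
  have hφc : ContDiff ℝ 1 fun t => φ (t + c) := by fun_prop
  have hKc : ∀ x, |φ (x + c)| ≤ K ∧ |deriv (fun t => φ (t + c)) x| ≤ K := fun x => by
    rw [deriv_comp_add_const]
    exact hK _
  have hφi : IntervalIntegrable (fun t => bernoulliSpline m (t / ε) * φ (t + c))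
      volume 0 (T - c) :=
    (intervalIntegrable_bernoulliSpline_div m ε _ _).mul_continuousOn
      (hφc.continuous.continuousOn)
  have hshift : ∫ t in 0..(T - c), |deriv D (t + c) - φ (t + c)|
      = ∫ t in c..T, |deriv D t - φ t| := by
    rw [intervalIntegral.integral_comp_add_right (fun t => |deriv D t - φ t|), zero_add,
      sub_add_cancel]
  have hci : IntervalIntegrable (fun t => |deriv D t - φ t|) volume c T :=
    hdiff.mono_set (by
      rw [uIcc_of_le hcT, uIcc_of_le hqT]
      exact Icc_subset_Icc_left hc)
  have hdi : IntervalIntegrable (fun t => |deriv D (t + c) - φ (t + c)|) volume 0 (T - c) := by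
    simpa using hci.comp_add_right c
  have hbd : ∀ t, ‖bernoulliSpline m (t / ε) * (deriv D (t + c) - φ (t + c))‖
      ≤ supAbs (bernoulliSpline m) (Icc 0 1) * |deriv D (t + c) - φ (t + c)| := fun t => by
    rw [norm_mul]
    exact mul_le_mul_of_nonneg_right (abs_bernoulliSpline_le _ _) (norm_nonneg _)
  have h1 : |∫ t in 0..(T - c), bernoulliSpline m (t / ε) * (deriv D (t + c) - φ (t + c))|
      ≤ supAbs (bernoulliSpline m) (Icc 0 1) * ∫ t in q..T, |deriv D t - φ t| := by
    refine (intervalIntegral.norm_integral_le_of_norm_le hT (ae_of_all _ fun t _ => hbd t)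
      (hdi.const_mul _)).trans ?_
    rw [intervalIntegral.integral_const_mul, hshift]
    refine mul_le_mul_of_nonneg_left ?_ (supAbs_nonneg _ _)
    exact intervalIntegral.integral_mono_interval hc hcT le_rfl
      (ae_of_all _ fun _ => abs_nonneg _) hdiff
  have hDi : IntervalIntegrable
      (fun t => bernoulliSpline m (t / ε) * (deriv D (t + c) - φ (t + c))) volume 0 (T - c) := by
    refine (hdi.const_mul (supAbs (bernoulliSpline m) (Icc 0 1))).mono_fun ?_
      (ae_of_all _ fun t => (hbd t).trans (le_abs_self _))
    exact ((measurable_bernoulliSpline m).comp (measurable_id.div_const ε)).aestronglyMeasurable.mul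
      (((measurable_deriv D).comp (measurable_add_const c)).sub
        hφc.continuous.measurable).aestronglyMeasurable
  rw [← integral_bernoulliSpline_mul m hε hT hprim]
  have hsplit : ∫ t in 0..(T - c), bernoulliSpline m (t / ε) * deriv D (t + c)
      = (∫ t in 0..(T - c), bernoulliSpline m (t / ε) * (deriv D (t + c) - φ (t + c)))
        + ∫ t in 0..(T - c), bernoulliSpline m (t / ε) * φ (t + c) := by
    rw [← intervalIntegral.integral_add hDi hφi]
    exact intervalIntegral.integral_congr fun t _ => by ring
  rw [hsplit]
  exact (abs_add_le _ _).trans (add_le_add h1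
    (abs_integral_bernoulliSpline_mul_le m hm hε hT hφc hKc))

/-- For a function of bounded variation, continuity at `0` rules out an atom of the variation there.
-/
theorem eventually_eVariationOn_uIcc_lt {D : ℝ → ℝ} {q : ℝ} (hq : q ≤ 0)
    (hD : ContinuousOn D (Ici q)) (hv : BoundedVariationOn D (Ici q)) {η : ℝ} (hη : 0 < η) :
    ∀ᶠ y in 𝓝[Ici q] 0, (eVariationOn D (uIcc 0 y)).toReal < η := by
  have hr := hv.tendsto_eVariationOn_Icc_zero_right 0 ((hD 0 hq).mono inter_subset_left)
  have hl := hv.tendsto_eVariationOn_Icc_zero_left ((hD 0 hq).mono inter_subset_left)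
  have hη' : 0 < ENNReal.ofReal η := ENNReal.ofReal_pos.2 hη
  filter_upwards [hr.eventually (gt_mem_nhds hη'), hl.eventually (gt_mem_nhds hη'),
    self_mem_nhdsWithin] with y hry hly hy
  have hsub : uIcc 0 y ⊆ Ici q := ordConnected_Ici.uIcc_subset hq hy
  have hlt : eVariationOn D (uIcc 0 y) < ENNReal.ofReal η := by
    rcases le_total 0 y with h | h
    · rw [uIcc_of_le h] at hsub ⊢
      rwa [inter_eq_self_of_subset_right hsub] at hry
    · rw [uIcc_of_ge h] at hsub ⊢
      rwa [inter_eq_self_of_subset_right hsub] at hly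
  exact (ENNReal.lt_ofReal_iff_toReal_lt hlt.ne_top).1 hlt

theorem exists_eVariationOn_Ici_lt {D : ℝ → ℝ} {q : ℝ} (hv : BoundedVariationOn D (Ici q))
    (c : ℝ) {η : ℝ} (hη : 0 < η) :
    ∃ T, c ≤ T ∧ q ≤ T ∧ (eVariationOn D (Ici T)).toReal < η := by
  have h := hv.tendsto_eVariationOn_Ici_zero
  rw [inf_of_le_right (le_principal_iff.2 (Ici_mem_atTop q))] at h
  obtain ⟨T, hT, hc, hq⟩ := ((h.eventually (gt_mem_nhds (ENNReal.ofReal_pos.2 hη))).and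
    ((eventually_ge_atTop c).and (eventually_ge_atTop q))).exists
  rw [inter_eq_self_of_subset_right (Ici_subset_Ici.2 hq)] at hT
  exact ⟨T, hc, hq, (ENNReal.lt_ofReal_iff_toReal_lt hT.ne_top).1 hT⟩

theorem eventually_abs_emRemainder_lt {D : ℝ → ℝ} {q : ℝ} (n : ℕ) (hq : q ≤ 0)
    (hD : ContinuousOn D (Ici q)) (hv : BoundedVariationOn D (Ici q))
    (hac : ∀ T ≥ q, AbsolutelyContinuousOnInterval D q T) (a : ℝ) {η : ℝ} (hη : 0 < η) :
    ∀ᶠ ε in 𝓝[>] (0 : ℝ), ∀ u, |u| ≤ a → q ≤ ε * u → |emRemainder n D ε u| < η := by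
  rcases lt_or_ge a 0 with ha | ha
  · exact .of_forall fun ε u hu => absurd ((abs_nonneg u).trans hu) (not_le.2 ha)
  set M := supAbs (bernoulliSpline (n + 1)) (Icc 0 1)
  set M' := supAbs (bernoulliSpline (n + 1 + 1)) (Icc 0 1)
  set C := supAbs (bernoulliFun (n + 1)) (Icc (-a) a)
  have hM : 0 ≤ M := supAbs_nonneg _ _
  have hM' : 0 ≤ M' := supAbs_nonneg _ _
  have hC : 0 ≤ C := supAbs_nonneg _ _
  -- The error splits into four quarters of `η`: tail beyond `T`, `L¹` approximation, oscillation
  -- against `φ`, and head. Dividing by `c + 1` covers `c = 0`.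
  have hsmall : ∀ {c v : ℝ}, 0 ≤ c → 0 ≤ v → v ≤ η / (4 * (c + 1)) → c * v ≤ η / 4 := by
    intro c v hc hv0 hv
    rw [le_div_iff₀ (by positivity)] at hv
    linarith
  -- The requirement `a ≤ T` ensures `εu ≤ T` for all `ε < 1` and `|u| ≤ a`. The cut is at the fixed
  -- point `T` of the argument of `D`, hence at `T - εu` in the integration variable.
  obtain ⟨T, haT, hqT, hT⟩ := exists_eVariationOn_Ici_lt hv a
    (show 0 < η / (4 * (M + 1)) by positivity)
  obtain ⟨φ, hφ, ⟨K, hK⟩, hφη⟩ := exists_contDiff_integral_abs_sub_le hqT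
    (hac T hqT).intervalIntegrable_deriv (show 0 < η / (4 * (M + 1)) by positivity)
  have hK0 : 0 ≤ K := (abs_nonneg _).trans (hK 0).1
  have hT0 : 0 ≤ T := ha.trans haT
  obtain ⟨δ, hδ, hδv⟩ := Metric.eventually_nhds_iff.1 (eventually_nhdsWithin_iff.1
    (eventually_eVariationOn_uIcc_lt hq hD hv (show 0 < η / (4 * (C + 1)) by positivity)))
  have e1 : ∀ᶠ ε in 𝓝[>] (0 : ℝ), ε < 1 := nhdsWithin_le_nhds (gt_mem_nhds one_pos)
  have e2 : ∀ᶠ ε in 𝓝[>] (0 : ℝ), ε * a < δ := by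
    have : Tendsto (fun ε : ℝ => ε * a) (𝓝 0) (𝓝 (0 * a)) := tendsto_id.mul_const a
    rw [zero_mul] at this
    exact nhdsWithin_le_nhds (this.eventually (gt_mem_nhds hδ))
  have e3 : ∀ᶠ ε in 𝓝[>] (0 : ℝ), ε * (M' * (K * (2 + (T + a)))) < η / 4 := by
    have : Tendsto (fun ε : ℝ => ε * (M' * (K * (2 + (T + a))))) (𝓝 0)
        (𝓝 (0 * (M' * (K * (2 + (T + a)))))) := tendsto_id.mul_const _
    rw [zero_mul] at this
    exact nhdsWithin_le_nhds (this.eventually (gt_mem_nhds (by positivity)))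
  filter_upwards [e1, e2, e3, self_mem_nhdsWithin] with ε hε1 hε2 hε3 hε u hu hqu
  rw [mem_Ioi] at hε
  obtain ⟨-, I, -, hL, htail⟩ := exists_emRemainder_eq n hq hε hqu hD hv
  have hεu : |ε * u| ≤ ε * a := by
    rw [abs_mul, abs_of_pos hε]
    exact mul_le_mul_of_nonneg_left hu hε.le
  have hεa : ε * a ≤ a := mul_le_of_le_one_left ha hε1.le
  have hεu' := abs_le.1 (hεu.trans hεa)
  have hcT : ε * u ≤ T := hεu'.2.trans haT
  have t1 := htail (T - ε * u) (by linarith)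
  rw [sub_add_cancel] at t1
  have t2 : M * (eVariationOn D (Ici T)).toReal ≤ η / 4 :=
    hsmall hM ENNReal.toReal_nonneg hT.le
  have t3 := abs_splineByParts_le (n + 1) n.succ_ne_zero hε hqu hcT (hac T hqT) hφ hK
  have t4 : M * (∫ t in q..T, |deriv D t - φ t|) ≤ η / 4 :=
    hsmall hM (intervalIntegral.integral_nonneg hqT fun _ _ => abs_nonneg _) hφη
  have t5 : ε * (M' * (K * (2 + (T - ε * u)))) ≤ ε * (M' * (K * (2 + (T + a)))) := by
    have : 2 + (T - ε * u) ≤ 2 + (T + a) := by linarith [hεu'.1]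
    gcongr
  have t6 := hasRSIntegral_head (n + 1) hq hqu hD
  have hv0 := hv.mono (uIcc_zero_subset_Ici hq hqu)
  have hle := eVariationOn_head_le D ε u
  have t7 : |headByParts (n + 1) D ε u| ≤ C * (eVariationOn D (uIcc 0 (ε * u))).toReal := by
    refine (t6.abs_le (M := C) (fun t ht => ?_) (ne_top_of_le_ne_top hv0 hle)).trans
      (mul_le_mul_of_nonneg_left (ENNReal.toReal_mono hv0 hle) hC)
    refine abs_le_supAbs_of_isCompact isCompact_Icc
      (continuous_bernoulliFun _).continuousOn ?_
    have := abs_le.1 hu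
    constructor <;> nlinarith [ht.1, ht.2]
  have t8 : C * (eVariationOn D (uIcc 0 (ε * u))).toReal ≤ η / 4 := by
    refine hsmall hC ENNReal.toReal_nonneg (hδv ?_ hqu).le
    rw [Real.dist_eq, sub_zero]
    exact hεu.trans_lt hε2
  rw [hL]
  have := abs_sub_abs_le_abs_sub I (splineByParts (n + 1) ε (fun t => D (t + ε * u)) (T - ε * u))
  have := abs_add_le I (headByParts (n + 1) D ε u)
  linarith

theorem mainTheorem5 :
    -- Part 1: nonnegative shifts
    (∀ (n : ℕ) (F : ℝ → ℝ),
      ContDiffOn ℝ n F (Ici 0) →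
      IntegrableOn F (Ici 0) →
      BoundedVariationOn (iteratedDerivWithin n F (Ici 0)) (Ici 0) →
      (∀ k ≤ n, Tendsto (iteratedDerivWithin k F (Ici 0)) atTop (𝓝 0)) →
      (∀ ε > (0 : ℝ), ∀ u ≥ (0 : ℝ),
        EMRemainderExists n (iteratedDerivWithin n F (Ici 0)) ε u ∧
        Tendsto (fun p : ℕ => ∑ k ∈ Finset.Icc 1 p, F (ε * k + ε * u)) atTop
          (𝓝 ((1 / ε) * (∫ t in Ioi (0 : ℝ), F t)
            + (∑ k ∈ Finset.range (n + 1), (-1) ^ k * ε ^ k / (Nat.factorial (k + 1) : ℝ)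
                * bernoulliFun (k + 1) (-u) * iteratedDerivWithin k F (Ici 0) 0)
            + (-1) ^ n * ε ^ n / (Nat.factorial (n + 1) : ℝ)
                * emRemainder n (iteratedDerivWithin n F (Ici 0)) ε u)) ∧
        |emRemainder n (iteratedDerivWithin n F (Ici 0)) ε u| ≤
          supAbs (bernoulliSpline (n + 1)) (Icc 0 1)
              * (eVariationOn (iteratedDerivWithin n F (Ici 0)) (Ici (ε * u))).toReal
            + supAbs (bernoulliFun (n + 1)) (Icc (-u) 0)
              * (eVariationOn (iteratedDerivWithin n F (Ici 0)) (Icc 0 (ε * u))).toReal) ∧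
      ((∀ T ≥ 0, AbsolutelyContinuousOnInterval (iteratedDerivWithin n F (Ici 0)) 0 T) →
        ∀ a > 0, TendstoUniformlyOn
          (fun ε u => emRemainder n (iteratedDerivWithin n F (Ici 0)) ε u)
          (fun _ => 0) (𝓝[>] 0) (Icc 0 a))) ∧
    -- Part 2: negative shifts
    (∀ (n : ℕ) (q : ℝ) (F : ℝ → ℝ), q < 0 →
      ContDiffOn ℝ n F (Ici q) →
      IntegrableOn F (Ici q) →
      BoundedVariationOn (iteratedDerivWithin n F (Ici q)) (Ici q) →
      (∀ k ≤ n, Tendsto (iteratedDerivWithin k F (Ici q)) atTop (𝓝 0)) →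
      (∀ u < (0 : ℝ), ∀ ε ∈ Ioo (0 : ℝ) (q / u),
        EMRemainderExists n (iteratedDerivWithin n F (Ici q)) ε u ∧
        Tendsto (fun p : ℕ => ∑ k ∈ Finset.Icc 1 p, F (ε * k + ε * u)) atTop
          (𝓝 ((1 / ε) * (∫ t in Ioi (0 : ℝ), F t)
            + (∑ k ∈ Finset.range (n + 1), (-1) ^ k * ε ^ k / (Nat.factorial (k + 1) : ℝ)
                * bernoulliFun (k + 1) (-u) * iteratedDerivWithin k F (Ici q) 0)
            + (-1) ^ n * ε ^ n / (Nat.factorial (n + 1) : ℝ)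
                * emRemainder n (iteratedDerivWithin n F (Ici q)) ε u)) ∧
        |emRemainder n (iteratedDerivWithin n F (Ici q)) ε u| ≤
          supAbs (bernoulliSpline (n + 1)) (Icc 0 1)
              * (eVariationOn (iteratedDerivWithin n F (Ici q)) (Ici (ε * u))).toReal
            + supAbs (bernoulliFun (n + 1)) (Icc 0 (-u))
              * (eVariationOn (iteratedDerivWithin n F (Ici q)) (Icc (ε * u) 0)).toReal) ∧
      ((∀ T ≥ q, AbsolutelyContinuousOnInterval (iteratedDerivWithin n F (Ici q)) q T) →
        ∀ b < 0, TendstoUniformlyOn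
          (fun ε u => emRemainder n (iteratedDerivWithin n F (Ici q)) ε u)
          (fun _ => 0) (𝓝[>] 0) (Icc b 0))) := by
  -- Both uniform limits are cases of this: `u` ranges over a bounded set and `εu` eventually stays
  -- in the domain of `F`.
  have key : ∀ (n : ℕ) (q : ℝ) (F : ℝ → ℝ), q ≤ 0 → ContDiffOn ℝ n F (Ici q) →
      BoundedVariationOn (iteratedDerivWithin n F (Ici q)) (Ici q) →
      (∀ T ≥ q, AbsolutelyContinuousOnInterval (iteratedDerivWithin n F (Ici q)) q T) →
      ∀ (a : ℝ) (s : Set ℝ), (∀ u ∈ s, |u| ≤ a) →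
      (∀ᶠ ε in 𝓝[>] (0 : ℝ), ∀ u ∈ s, q ≤ ε * u) →
      TendstoUniformlyOn (fun ε u => emRemainder n (iteratedDerivWithin n F (Ici q)) ε u)
          (fun _ => 0) (𝓝[>] 0) s := by
    intro n q F hq hF hv hac a s hs hsq
    rw [Metric.tendstoUniformlyOn_iff]
    intro η hη
    filter_upwards [hsq, eventually_abs_emRemainder_lt n hq
      (continuousOn_iteratedDerivWithin_Ici hF le_rfl) hv hac a hη] with ε h1 h2 u hu
    rw [dist_comm, Real.dist_eq, sub_zero]
    exact h2 u (hs u hu) (h1 u hu)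
  refine ⟨fun n F hF hint hv hlim => ⟨fun ε hε u hu => ?_, fun hac a ha => ?_⟩,
    fun n q F hq hF hint hv hlim => ⟨fun u hu ε hε => ?_, fun hac b hb => ?_⟩⟩
  · have hεu : 0 ≤ ε * u := mul_nonneg hε.le hu
    have hD := continuousOn_iteratedDerivWithin_Ici hF le_rfl
    refine ⟨(exists_emRemainder_eq n le_rfl hε hεu hD hv).1,
      tendsto_sum_eulerMaclaurin le_rfl hF hint hv hlim hε hεu, ?_⟩
    have := abs_emRemainder_le n le_rfl hε hεu hD hv
    rwa [uIcc_of_le hεu, uIcc_of_le (neg_nonpos.2 hu)] at this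
  · refine key n 0 F le_rfl hF hv hac a _ (fun u hu => ?_) ?_
    · rw [abs_of_nonneg hu.1]
      exact hu.2
    · filter_upwards [self_mem_nhdsWithin] with ε hε u hu
      exact mul_nonneg (mem_Ioi.1 hε).le hu.1
  · obtain ⟨hε, hεq⟩ := hε
    have hqu : q ≤ ε * u := by
      rw [lt_div_iff_of_neg hu] at hεq
      exact hεq.le
    have hεu : ε * u ≤ 0 := mul_nonpos_of_nonneg_of_nonpos hε.le hu.le
    have hD := continuousOn_iteratedDerivWithin_Ici hF le_rfl
    refine ⟨(exists_emRemainder_eq n hq.le hε hqu hD hv).1,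
      tendsto_sum_eulerMaclaurin hq.le hF hint hv hlim hε hqu, ?_⟩
    have := abs_emRemainder_le n hq.le hε hqu hD hv
    rwa [uIcc_of_ge hεu, uIcc_of_ge (neg_nonneg.2 hu.le)] at this
  · refine key n q F hq.le hF hv hac (-b) _ (fun u hu => ?_) ?_
    · rw [abs_of_nonpos hu.2]
      exact neg_le_neg hu.1
    -- The constraint is tightest at `u = b`, and `εb → 0 > q`.
    · have h : Tendsto (fun ε : ℝ => ε * b) (𝓝 0) (𝓝 (0 * b)) := tendsto_id.mul_const b
      rw [zero_mul] at h
      filter_upwards [nhdsWithin_le_nhds (h.eventually (lt_mem_nhds hq)),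
        self_mem_nhdsWithin] with ε hε hε0 u hu
      exact hε.le.trans (mul_le_mul_of_nonneg_left hu.1 (mem_Ioi.1 hε0).le)
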